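/- **Theorem 3.16 (the general Jacobi identity).** *Conventions.* Let $k$ be a commutative ring. A Weil algebra is a commutative $k$-algebra $W$, finitely generated and free as a $k$-module, with an augmentation $W\to k$ whose kernel is nilpotent; morphisms are the $k$-algebra homomorphisms that respect the augmentations. For a set $\mathfrak p$ of pairs, let $\mathcal W_{D^n\{\mathfrak p\}}=k[X_1,\dots,X_n]/(X_i^2,\ X_iX_j : (i,j)\in\mathfrak p)$ with $X_i\mapsto 0$ as augmentation, $D^n=D^n\{\emptyset\}$, $D=D^1$ and $D(2)=D^2\{(1,2)\}$; a polynomial map $f:D^m\{\mathfrak q\}\to D^n\{\mathfrak p\}$ with $f(0)=0$ induces $\mathcal W_f:\mathcal W_{D^n\{\mathfrak p\}}\to\mathcal W_{D^m\{\mathfrak q\}}$. A DG-category $(\mathcal K,\mathbb R,\mathbf T,\alpha)$ consists of a category $\mathcal K$ with finite limits, a commutative $k$-algebra object $\mathbb R$, left exact functors $\mathbf T^W=(-)\otimes W:\mathcal K\to\mathcal K$ for the Weil algebras $W$, and natural transformations $\alpha_\varphi=\mathrm{id}\otimes\varphi:\mathbf T^W\to\mathbf T^V$ for $\varphi:W\to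 V$, functorial in $\varphi$, such that $\mathbf T^k=\mathrm{id}$, $\mathbf T^V\circ\mathbf T^W=\mathbf T^{W\otimes_kV}$, $\mathbf T^W\mathbb R=\mathbb R\otimes_k W$ as $k$-algebra objects and $\alpha_\varphi(\mathbb R)=\mathbb R\otimes\varphi$; these equalities are coherent natural isomorphisms. An object $M$ is microlinear if $M\otimes(-)$ turns every cone over a finite diagram of Weil algebras that is a limit cone of commutative $k$-algebras into a limit cone. It is Weil-exponentiable if for all objects $X$ and Weil algebras $W,V$ the exponential $(M\otimes W)^X$ exists and $(M\otimes W)^X\otimes V$, with the canonical evaluation, is an exponential $(M\otimes(W\otimes_k V))^X$. *Strong differences.* Let $M$ be microlinear. For $1\le i<j\le n$, with the inclusion $D^n\{(i,j)\}\to D^n$ used for both factors, microlinearity gives $$(M\otimes\mathcal W_{D^n})\times_{M\otimes\mathcal W_{D^n\{(i,j)\}}}(M\otimes\mathcal W_{D^n})=M\otimes\mathcal W_{D^{n+1}\{(i,n+1),(j,n+1)\}},$$ the projections being induced by $(d_1,\dots,d_n)\mapsto(d_1,\dots,d_n,0)$ and $(d_1,\dots,d_n)\mapsto(d_1,\dots,d_n,d_id_j)$.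 For $n=2$ let $$\zeta:(M\otimes\mathcal W_{D^2})\times_{M\otimes\mathcal W_{D(2)}}(M\otimes\mathcal W_{D^2})\to M\otimes\mathcal W_D$$ be this identification followed by the morphism induced by $d\mapsto(0,0,d)$. For $n=3$, $l\in\{1,2,3\}$ and $\{i<j\}=\{1,2,3\}\setminus\{l\}$ put $P_l=(M\otimes\mathcal W_{D^3})\times_{M\otimes\mathcal W_{D^3\{(i,j)\}}}(M\otimes\mathcal W_{D^3})$ and let $$\zeta_l:P_l\to M\otimes\mathcal W_{D^2}$$ be this identification followed by the morphism induced by the map $D^2\to D^4$ sending $(d_1,d_2)$ to the point with $l$-th coordinate $d_1$, fourth coordinate $d_2$ and the other coordinates $0$. Let $Q_l=P_l\times_{M\otimes\mathcal W_{D(2)}}P_l$ be formed along the composite of $\zeta_l$ and $M\otimes\mathcal W_{D^2}\to M\otimes\mathcal W_{D(2)}$. The object $Q_l$ has four projections to $M\otimes\mathcal W_{D^3}$, labelled, in order, by $$321,231,132,123\ (l=1);\qquad 132,312,213,231\ (l=2);\qquad 213,123,321,312\ (l=3).$$ *The hexagon.* Let $\Delta$ be the limit of the diagram formed by $Q_1,Q_2,Q_3$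 and three copies of $(M\otimes\mathcal W_{D^3})\times_M(M\otimes\mathcal W_{D^3})=M\otimes\mathcal W_{D^3\oplus D^3}$, in which $Q_1$ and $Q_2$ are mapped to the first copy by the projections labelled $231,132$, the objects $Q_2$ and $Q_3$ to the second one by those labelled $312,213$, and $Q_3$ and $Q_1$ to the third one by those labelled $123,321$. For $l=1,2,3$ let $$Z_l:\Delta\to Q_l\xrightarrow{\ \zeta_l\times\zeta_l\ }(M\otimes\mathcal W_{D^2})\times_{M\otimes\mathcal W_{D(2)}}(M\otimes\mathcal W_{D^2})\xrightarrow{\ \zeta\ }M\otimes\mathcal W_D .$$ These are the morphisms $Z_1=\zeta^{(\ast_{123}\overset{\cdot}{\underset{1}{-}}\ast_{132})\overset{\cdot}{-}(\ast_{231}\overset{\cdot}{\underset{1}{-}}\ast_{321})}$, $Z_2=\zeta^{(\ast_{231}\overset{\cdot}{\underset{2}{-}}\ast_{213})\overset{\cdot}{-}(\ast_{312}\overset{\cdot}{\underset{2}{-}}\ast_{132})}$ and $Z_3=\zeta^{(\ast_{312}\overset{\cdot}{\underset{3}{-}}\ast_{321})\overset{\cdot}{-}(\ast_{123}\overset{\cdot}{\underset{3}{-}}\ast_{213})}$.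 *Theorem.* Let $M$ be a microlinear and Weil-exponentiable object of a DG-category. Then $Z_1,Z_2,Z_3$ have the same composite $\Delta\to M$ with the projection $M\otimes\mathcal W_D\to M$, and with respect to the fibrewise addition $$(M\otimes\mathcal W_D)\times_M(M\otimes\mathcal W_D)=M\otimes\mathcal W_{D(2)}\to M\otimes\mathcal W_D$$ (the last morphism being induced by $d\mapsto(d,d)$) they sum up to zero: $Z_1+Z_2+Z_3$ is the common composite $\Delta\to M$ followed by the zero section $M\to M\otimes\mathcal W_D$. -/

import Mathlib

open CategoryTheory CategoryTheory.Limits TensorProduct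

universe u v w

/-! ## Weil algebras -/

/-- A Weil `k`-algebra: a commutative `k`-algebra, finitely generated and free as a `k`-module,
with an augmentation onto `k` whose kernel is a nilpotent ideal. -/
structure WeilAlg (k : Type u) [CommRing k] where
  carrier : Type u
  [commRing : CommRing carrier]
  [algebra : Algebra k carrier]
  [finite : Module.Finite k carrier]
  [free : Module.Free k carrier]
  aug : carrier →ₐ[k] k
  nilp : IsNilpotent (RingHom.ker aug)

namespace WeilAlg

variable {k : Type u} [CommRing k]

attribute [instance] commRing algebra finite free

instance : CoeSort (WeilAlg k) (Type u) := ⟨carrier⟩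

/-- Morphisms of Weil algebras are the `k`-algebra homomorphisms that respect the augmentations
(the latter is automatic when `k` is a field). -/
@[ext]
structure Hom (W V : WeilAlg k) where
  alg : W →ₐ[k] V
  aug_comp : V.aug.comp alg = W.aug

instance : Category (WeilAlg k) where
  Hom W V := Hom W V
  id W := ⟨AlgHom.id k W, rfl⟩
  comp f g := ⟨g.alg.comp f.alg, by rw [← AlgHom.comp_assoc, g.aug_comp, f.aug_comp]⟩

@[ext]
theorem hom_ext {W V : WeilAlg k} {f g : W ⟶ V} (h : f.alg = g.alg) : f = g := Hom.ext h

@[simp] theorem id_alg (W : WeilAlg k) : Hom.alg (𝟙 W) = AlgHom.id k W := rfl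

@[simp] theorem comp_alg {U V W : WeilAlg k} (f : U ⟶ V) (g : V ⟶ W) :
    (f ≫ g).alg = g.alg.comp f.alg := rfl

/-- The inclusion of Weil algebras into all commutative `k`-algebras. -/
def toAlg (k : Type u) [CommRing k] : WeilAlg k ⥤ CommAlgCat.{u} k where
  obj W := CommAlgCat.of k W
  map f := CommAlgCat.ofHom f.alg

/-- The Weil algebra `k`. -/
def base (k : Type u) [CommRing k] : WeilAlg k where
  carrier := k
  aug := AlgHom.id k k
  nilp := ⟨1, by
    rw [pow_one]
    exact (RingHom.injective_iff_ker_eq_bot _).1 Function.injective_id⟩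

/-- The unit `k ⟶ W`. -/
def unit (W : WeilAlg k) : base k ⟶ W :=
  ⟨(Algebra.ofId k W : k →ₐ[k] W), Subsingleton.elim (α := k →ₐ[k] k) _ _⟩

/-- The augmentation `W ⟶ k`. -/
def toBase (W : WeilAlg k) : W ⟶ base k := ⟨W.aug, AlgHom.id_comp _⟩

theorem aug_surjective (W : WeilAlg k) : Function.Surjective W.aug := fun c =>
  ⟨algebraMap k W c, by simp⟩

/-- The tensor product of Weil algebras. -/
noncomputable def tensor (W V : WeilAlg k) : WeilAlg k where
  carrier := W ⊗[k] V
  aug := (Algebra.TensorProduct.lid k k).toAlgHom.comp (Algebra.TensorProduct.map W.aug V.aug)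
  nilp := by
    have h : RingHom.ker ((Algebra.TensorProduct.lid k k).toAlgHom.comp
        (Algebra.TensorProduct.map W.aug V.aug)) =
        RingHom.ker (Algebra.TensorProduct.map W.aug V.aug) := by
      ext x
      simp [RingHom.mem_ker]
    rw [h, Algebra.TensorProduct.map_ker _ _ W.aug_surjective V.aug_surjective]
    have hn : ∀ {A B : Type u} [CommRing A] [CommRing B] (f : A →+* B) (I : Ideal A),
        IsNilpotent I → IsNilpotent (I.map f) := by
      rintro A B _ _ f I ⟨n, h⟩
      exact ⟨n, by rw [← Ideal.map_pow, h]; exact Ideal.map_bot⟩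
    exact (Commute.all _ _).isNilpotent_add (hn _ _ W.nilp) (hn _ _ V.nilp)

@[simp] theorem tensor_aug_tmul (W V : WeilAlg k) (a : W) (b : V) :
    (W.tensor V).aug (a ⊗ₜ[k] b : W ⊗[k] V) = W.aug a * V.aug b := by
  change Algebra.TensorProduct.lid k k (Algebra.TensorProduct.map W.aug V.aug (a ⊗ₜ[k] b)) = _
  simp

/-- The tensor product of morphisms of Weil algebras. -/
noncomputable def tensorMap {W W' V V' : WeilAlg k} (f : W ⟶ W') (g : V ⟶ V') :
    W.tensor V ⟶ W'.tensor V' where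
  alg := (Algebra.TensorProduct.map f.alg g.alg : W ⊗[k] V →ₐ[k] W' ⊗[k] V')
  aug_comp := by
    apply Algebra.TensorProduct.ext'
    intro a b
    have hf : W'.aug (f.alg a) = W.aug a := DFunLike.congr_fun f.aug_comp a
    have hg : V'.aug (g.alg b) = V.aug b := DFunLike.congr_fun g.aug_comp b
    refine (tensor_aug_tmul W' V' (f.alg a) (g.alg b)).trans ?_
    refine Eq.trans ?_ (tensor_aug_tmul W V a b).symm
    rw [hf, hg]

/-- The associativity morphism `(U ⊗ V) ⊗ W ⟶ U ⊗ (V ⊗ W)`. -/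
noncomputable def assoc (U V W : WeilAlg k) :
    (U.tensor V).tensor W ⟶ U.tensor (V.tensor W) where
  alg := ((Algebra.TensorProduct.assoc k k k U V W).toAlgHom :
    (U ⊗[k] V) ⊗[k] W →ₐ[k] U ⊗[k] (V ⊗[k] W))
  aug_comp := by
    apply Algebra.TensorProduct.ext
    · apply Algebra.TensorProduct.ext'
      intro a b
      change (U.tensor (V.tensor W)).aug (a ⊗ₜ[k] (b ⊗ₜ[k] (1 : W) : V ⊗[k] W)) =
        ((U.tensor V).tensor W).aug ((a ⊗ₜ[k] b : U ⊗[k] V) ⊗ₜ[k] (1 : W))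
      refine (tensor_aug_tmul U (V.tensor W) a _).trans ?_
      refine Eq.trans ?_ (tensor_aug_tmul (U.tensor V) W _ 1).symm
      rw [tensor_aug_tmul, tensor_aug_tmul, mul_assoc]
    · ext c
      change (U.tensor (V.tensor W)).aug ((1 : U) ⊗ₜ[k] ((1 : V) ⊗ₜ[k] c : V ⊗[k] W)) =
        ((U.tensor V).tensor W).aug (((1 : U) ⊗ₜ[k] (1 : V) : U ⊗[k] V) ⊗ₜ[k] c)
      refine (tensor_aug_tmul U (V.tensor W) 1 _).trans ?_
      refine Eq.trans ?_ (tensor_aug_tmul (U.tensor V) W _ c).symm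
      rw [tensor_aug_tmul, tensor_aug_tmul, mul_assoc]

/-- The identification `k ⊗ W ⟶ W`. -/
noncomputable def lid (W : WeilAlg k) : (base k).tensor W ⟶ W where
  alg := ((Algebra.TensorProduct.lid k W).toAlgHom : k ⊗[k] W →ₐ[k] W)
  aug_comp := by
    apply Algebra.TensorProduct.ext'
    intro (a : k) b
    refine Eq.trans ?_ (tensor_aug_tmul (base k) W a b).symm
    change W.aug (a • b) = a * W.aug b
    simp

/-- The identification `W ⊗ k ⟶ W`. -/
noncomputable def rid (W : WeilAlg k) : W.tensor (base k) ⟶ W where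
  alg := ((Algebra.TensorProduct.rid k k W).toAlgHom : W ⊗[k] k →ₐ[k] W)
  aug_comp := by
    apply Algebra.TensorProduct.ext'
    intro a (b : k)
    refine Eq.trans ?_ (tensor_aug_tmul W (base k) a b).symm
    change W.aug (b • a) = W.aug a * b
    simp [mul_comm]

end WeilAlg

/-! ## The Weil algebras of simplicial infinitesimal objects -/

namespace Simplicial

variable (k : Type u) [CommRing k]

/-- The ideal of `k[X₁, …, Xₙ]` generated by the `Xᵢ²` and by the `Xᵢ Xⱼ` with `(i, j) ∈ p`. -/
noncomputable def relIdeal (n : ℕ) (p : Set (Fin n × Fin n)) : Ideal (MvPolynomial (Fin n) k) :=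
  Ideal.span ({f | ∃ i, f = MvPolynomial.X i * MvPolynomial.X i} ∪
    {f | ∃ a ∈ p, f = MvPolynomial.X a.1 * MvPolynomial.X a.2})

/-- The coordinate algebra of
`Dⁿ{p} = {(d₁, …, dₙ) | dᵢ² = 0 for all i, and dᵢ dⱼ = 0 for all (i, j) ∈ p}`. -/
abbrev Alg (n : ℕ) (p : Set (Fin n × Fin n)) : Type u :=
  MvPolynomial (Fin n) k ⧸ relIdeal k n p

variable {n : ℕ} {p : Set (Fin n × Fin n)}

/-- The exponents of the monomials that lie in the ideal. -/
def Bad (p : Set (Fin n × Fin n)) (m : Fin n →₀ ℕ) : Prop :=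
  (∃ i, Finsupp.single i 1 + Finsupp.single i 1 ≤ m) ∨
    ∃ a ∈ p, Finsupp.single a.1 1 + Finsupp.single a.2 1 ≤ m

theorem mem_relIdeal {f : MvPolynomial (Fin n) k} :
    f ∈ relIdeal k n p ↔ ∀ m ∈ f.support, Bad p m := by
  have h : relIdeal k n p = Ideal.span ((fun s => MvPolynomial.monomial s (1 : k)) ''
      ({s | ∃ i, s = Finsupp.single i 1 + Finsupp.single i 1} ∪
        {s | ∃ a ∈ p, s = Finsupp.single a.1 1 + Finsupp.single a.2 1})) := by
    unfold relIdeal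
    congr 1
    ext f
    simp only [Set.mem_union, Set.mem_ofPred_eq, Set.mem_image, MvPolynomial.X,
      MvPolynomial.monomial_mul, mul_one]
    constructor
    · rintro (⟨i, rfl⟩ | ⟨a, ha, rfl⟩)
      · exact ⟨_, Or.inl ⟨i, rfl⟩, rfl⟩
      · exact ⟨_, Or.inr ⟨a, ha, rfl⟩, rfl⟩
    · rintro ⟨_, ⟨i, rfl⟩ | ⟨a, ha, rfl⟩, rfl⟩
      · exact Or.inl ⟨i, rfl⟩
      · exact Or.inr ⟨a, ha, rfl⟩
  rw [h, MvPolynomial.mem_ideal_span_monomial_image]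
  refine forall₂_congr fun m _ => ?_
  constructor
  · rintro ⟨_, ⟨i, rfl⟩ | ⟨a, ha, rfl⟩, hm⟩
    · exact Or.inl ⟨i, hm⟩
    · exact Or.inr ⟨a, ha, hm⟩
  · rintro (⟨i, hm⟩ | ⟨a, ha, hm⟩)
    · exact ⟨_, Or.inl ⟨i, rfl⟩, hm⟩
    · exact ⟨_, Or.inr ⟨a, ha, rfl⟩, hm⟩

/-- The monomials outside the ideal span a complement of it. -/
theorem isCompl : IsCompl ((relIdeal k n p).restrictScalars k)
    (MvPolynomial.restrictSupport k {m | ¬ Bad p m}) := by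
  have h : (relIdeal k n p).restrictScalars k = MvPolynomial.restrictSupport k {m | Bad p m} := by
    ext f
    rw [Submodule.restrictScalars_mem, mem_relIdeal, MvPolynomial.mem_restrictSupport_iff]
    rfl
  rw [h]
  constructor
  · rw [Submodule.disjoint_def]
    intro f h1 h2
    rw [MvPolynomial.mem_restrictSupport_iff] at h1 h2
    rw [← MvPolynomial.support_eq_empty, Finset.eq_empty_iff_forall_notMem]
    exact fun m hm => h2 hm (h1 hm)
  · rw [codisjoint_iff, eq_top_iff]
    intro f _
    induction f using MvPolynomial.induction_on' with
    | monomial m c =>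
      by_cases hm : Bad p m
      · exact Submodule.mem_sup_left ((MvPolynomial.monomial_mem_restrictSupport k).2 (Or.inl hm))
      · exact Submodule.mem_sup_right ((MvPolynomial.monomial_mem_restrictSupport k).2 (Or.inl hm))
    | add f g hf hg => exact add_mem (hf trivial) (hg trivial)

theorem finite_not_bad (p : Set (Fin n × Fin n)) :
    ({m | ¬ Bad p m} : Set (Fin n →₀ ℕ)).Finite := by
  refine Set.Finite.subset (Set.finite_Iic (Finsupp.equivFunOnFinite.symm fun _ => 1)) ?_
  intro m hm i
  by_contra h
  refine hm (Or.inl ⟨i, ?_⟩)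
  intro j
  have h' : 2 ≤ m i := not_le.1 h
  by_cases hj : i = j
  · subst hj
    simpa using h'
  · simp [hj]

noncomputable def equivRestrict :
    Alg k n p ≃ₗ[k] MvPolynomial.restrictSupport k {m | ¬ Bad p m} :=
  (Submodule.Quotient.restrictScalarsEquiv k (relIdeal k n p)).symm.trans
    (Submodule.quotientEquivOfIsCompl _ _ (isCompl k))

instance : Module.Free k (Alg k n p) :=
  Module.Free.of_basis ((MvPolynomial.basisRestrictSupport k _).map (equivRestrict k).symm)

instance : Module.Finite k (Alg k n p) :=
  haveI := (finite_not_bad p).to_subtype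
  Module.Finite.of_basis ((MvPolynomial.basisRestrictSupport k _).map (equivRestrict k).symm)

/-- The `i`-th coordinate function. -/
noncomputable def x (i : Fin n) : Alg k n p :=
  Ideal.Quotient.mk _ (MvPolynomial.X i)

theorem x_sq (i : Fin n) : (x k i * x k i : Alg k n p) = 0 := by
  rw [x, ← map_mul, Ideal.Quotient.eq_zero_iff_mem]
  exact Ideal.subset_span (Or.inl ⟨i, rfl⟩)

theorem x_rel {i j : Fin n} (h : (i, j) ∈ p) : (x k i * x k j : Alg k n p) = 0 := by
  rw [x, x, ← map_mul, Ideal.Quotient.eq_zero_iff_mem]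
  exact Ideal.subset_span (Or.inr ⟨_, h, rfl⟩)

variable {k}

/-- The `k`-algebra homomorphism out of the coordinate algebra with prescribed values at the
coordinate functions. -/
noncomputable def lift {B : Type u} [CommRing B] [Algebra k B] (f : Fin n → B)
    (hsq : ∀ i, f i * f i = 0) (hrel : ∀ i j, (i, j) ∈ p → f i * f j = 0) :
    Alg k n p →ₐ[k] B :=
  Ideal.Quotient.liftₐ _ (MvPolynomial.aeval f) fun a ha => by
    have : relIdeal k n p ≤ RingHom.ker (MvPolynomial.aeval f : _ →ₐ[k] B) := by
      refine Ideal.span_le.2 ?_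
      rintro g (⟨i, rfl⟩ | ⟨⟨i, j⟩, hij, rfl⟩)
      · simpa [RingHom.mem_ker] using hsq i
      · simpa [RingHom.mem_ker] using hrel i j hij
    exact this ha

@[simp] theorem lift_x {B : Type u} [CommRing B] [Algebra k B] (f : Fin n → B) (hsq) (hrel)
    (i : Fin n) : lift (k := k) (p := p) f hsq hrel (x k i) = f i := by
  change MvPolynomial.aeval f (MvPolynomial.X i) = f i
  simp

theorem algHom_ext {B : Type u} [CommRing B] [Algebra k B] {f g : Alg k n p →ₐ[k] B}
    (h : ∀ i, f (x k i) = g (x k i)) : f = g := by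
  apply Ideal.Quotient.algHom_ext
  apply MvPolynomial.algHom_ext
  exact h

theorem induction_on {P : Alg k n p → Prop} (t : Alg k n p)
    (hC : ∀ c, P (algebraMap k _ c)) (hadd : ∀ s t, P s → P t → P (s + t))
    (hmul : ∀ t i, P t → P (t * x k i)) : P t := by
  obtain ⟨f, rfl⟩ := Ideal.Quotient.mk_surjective t
  induction f using MvPolynomial.induction_on with
  | C c => exact hC c
  | add f g hf hg => rw [map_add]; exact hadd _ _ hf hg
  | mul_X f i hf => rw [map_mul]; exact hmul _ _ hf

end Simplicial

namespace WeilAlg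

open Simplicial

variable (k : Type u) [CommRing k]

/-- The Weil algebra of `Dⁿ{p}`; the augmentation is evaluation at `(0, …, 0)`. -/
noncomputable def W (n : ℕ) (p : Set (Fin n × Fin n)) : WeilAlg k where
  carrier := Alg k n p
  aug := Simplicial.lift (fun _ => 0) (by simp) (by simp)
  nilp := by
    have hker : RingHom.ker (Simplicial.lift (k := k) (p := p) (B := k) (fun _ => 0) (by simp)
        (by simp)) = Ideal.span (Set.range (x k : Fin n → Alg k n p)) := by
      apply le_antisymm
      · intro t ht
        have key : ∀ t : Alg k n p, t - algebraMap k _ (Simplicial.lift (k := k) (p := p) (B := k)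
            (fun _ => 0) (by simp) (by simp) t) ∈
              Ideal.span (Set.range (x k : Fin n → Alg k n p)) := by
          intro t
          refine Simplicial.induction_on (P := fun t => t - algebraMap k _ (Simplicial.lift (k := k)
            (p := p) (B := k) (fun _ => 0) (by simp) (by simp) t) ∈
              Ideal.span (Set.range (x k : Fin n → Alg k n p))) t ?_ ?_ ?_
          · intro c
            simp
          · intro s t hs ht
            rw [map_add, map_add, add_sub_add_comm]
            exact add_mem hs ht
          · intro t i _
            rw [map_mul, lift_x, mul_zero, map_zero, sub_zero]
            exact Ideal.mul_mem_left _ _ (Ideal.subset_span ⟨i, rfl⟩)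
        have := key t
        rwa [RingHom.mem_ker.1 ht, map_zero, sub_zero] at this
      · refine Ideal.span_le.2 ?_
        rintro _ ⟨i, rfl⟩
        simp [RingHom.mem_ker]
    rw [hker]
    refine (Ideal.FG.isNilpotent_iff_le_nilradical
      (Submodule.fg_span (Set.finite_range _))).2 (Ideal.span_le.2 ?_)
    rintro _ ⟨i, rfl⟩
    exact ⟨2, by rw [pow_two, x_sq]; rfl⟩

variable {k}

/-- The coordinate functions on `Dⁿ{p}`. -/
noncomputable def X {n : ℕ} {p : Set (Fin n × Fin n)} (i : Fin n) : W k n p := x k i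

section
variable {n : ℕ} {p : Set (Fin n × Fin n)}

theorem X_sq (i : Fin n) : (X i * X i : W k n p) = 0 := x_sq k i

theorem X_rel {i j : Fin n} (h : (i, j) ∈ p) : (X i * X j : W k n p) = 0 := x_rel k h

@[simp] theorem aug_X (i : Fin n) : (W k n p).aug (X i) = 0 :=
  lift_x (k := k) (p := p) (B := k) (fun _ => 0) (by simp) (by simp) i

/-- The morphism `𝒲_f : 𝒲_{Dⁿ{p}} ⟶ V` of Weil algebras determined by an infinitesimal mapping
`f`, given by its components `f₁, …, fₙ ∈ V`. In particular, for `V = 𝒲_{Dᵐ{q}}` it belongs to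
`f : Dᵐ{q} → Dⁿ{p}, d ↦ (f₁(d), …, fₙ(d))`. -/
noncomputable def ofMap {V : WeilAlg k} (f : Fin n → V) (hsq : ∀ i, f i * f i = 0)
    (hrel : ∀ i j, (i, j) ∈ p → f i * f j = 0) (haug : ∀ i, V.aug (f i) = 0) :
    W k n p ⟶ V where
  alg := Simplicial.lift f hsq hrel
  aug_comp := Simplicial.algHom_ext fun i => by
    refine Eq.trans ?_ (aug_X i).symm
    exact (congrArg V.aug (lift_x f hsq hrel i)).trans (haug i)

@[simp] theorem ofMap_X {V : WeilAlg k} (f : Fin n → V) (hsq) (hrel) (haug) (i : Fin n) :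
    (ofMap (p := p) f hsq hrel haug).alg (X i) = f i :=
  lift_x f hsq hrel i

theorem W_induction {P : W k n p → Prop} (t : W k n p)
    (hC : ∀ c, P (algebraMap k (W k n p) c)) (hadd : ∀ s t, P s → P t → P (s + t))
    (hmul : ∀ t i, P t → P (t * X i)) : P t :=
  Simplicial.induction_on t hC hadd hmul

theorem hom_ext_X {V : WeilAlg k} {f g : W k n p ⟶ V} (h : ∀ i, f.alg (X i) = g.alg (X i)) :
    f = g :=
  hom_ext (Simplicial.algHom_ext h)

end

end WeilAlg

/-! ## The infinitesimal mappings that are used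

The coordinates of `Dⁿ` are numbered `0, …, n - 1`. -/

namespace WeilAlg

variable {k : Type u} [CommRing k]

/-- The inclusion `Dⁿ{(i, j)} → Dⁿ`. -/
noncomputable def incl (n : ℕ) (i j : Fin n) : W k n ∅ ⟶ W k n {(i, j)} :=
  ofMap X X_sq (by simp) aug_X

/-- The relations of `Dⁿ⁺¹{(i, n), (j, n)}`, the last coordinate being the `n`-th. -/
abbrev lastRel (n : ℕ) (i j : Fin n) : Set (Fin (n + 1) × Fin (n + 1)) :=
  {(i.castSucc, Fin.last n), (j.castSucc, Fin.last n)}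

/-- The mapping `Dⁿ → Dⁿ⁺¹{(i, n), (j, n)}, d ↦ (d₀, …, dₙ₋₁, 0)`. -/
noncomputable def phi (n : ℕ) (i j : Fin n) : W k (n + 1) (lastRel n i j) ⟶ W k n ∅ :=
  ofMap (Fin.snoc (α := fun _ => W k n ∅) X 0)
    (fun a => by induction a using Fin.lastCases <;> simp [X_sq])
    (by rintro a b (h | h) <;> obtain ⟨rfl, rfl⟩ := Prod.ext_iff.1 h <;> simp)
    (fun a => by induction a using Fin.lastCases <;> simp)

/-- The mapping `Dⁿ → Dⁿ⁺¹{(i, n), (j, n)}, d ↦ (d₀, …, dₙ₋₁, dᵢ dⱼ)`. -/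
noncomputable def psi (n : ℕ) (i j : Fin n) : W k (n + 1) (lastRel n i j) ⟶ W k n ∅ :=
  ofMap (Fin.snoc (α := fun _ => W k n ∅) X (X i * X j))
    (fun a => by
      induction a using Fin.lastCases with
      | last => simp only [Fin.snoc_last]; rw [mul_mul_mul_comm, X_sq, zero_mul]
      | cast a => simp [X_sq])
    (by
      rintro a b (h | h) <;> obtain ⟨rfl, rfl⟩ := Prod.ext_iff.1 h <;>
        simp only [Fin.snoc_last, Fin.snoc_castSucc]
      · rw [← mul_assoc, X_sq, zero_mul]
      · rw [mul_left_comm, X_sq, mul_zero])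
    (fun a => by induction a using Fin.lastCases <;> simp)

theorem phi_incl (n : ℕ) (i j : Fin n) :
    (phi n i j : W k _ _ ⟶ _) ≫ incl n i j = psi n i j ≫ incl n i j := by
  refine hom_ext_X fun a => ?_
  change (incl n i j).alg ((phi n i j).alg (X a)) = (incl n i j).alg ((psi n i j).alg (X a))
  induction a using Fin.lastCases with
  | last =>
    simp only [phi, psi, ofMap_X, Fin.snoc_last, map_mul, map_zero]
    rw [incl, ofMap_X, ofMap_X, X_rel (by simp)]
  | cast a => simp only [phi, psi, ofMap_X, Fin.snoc_castSucc]

/-- The projection `Dⁿ⁺¹{(i, n), (j, n)} → Dⁿ`. -/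
noncomputable def sect (n : ℕ) (i j : Fin n) : W k n ∅ ⟶ W k (n + 1) (lastRel n i j) :=
  ofMap (fun a => X a.castSucc) (fun _ => X_sq _) (by simp) (fun _ => aug_X _)

theorem sect_phi (n : ℕ) (i j : Fin n) (a : W k n ∅) :
    (phi n i j).alg ((sect n i j).alg a) = a := by
  have : sect n i j ≫ phi n i j = 𝟙 (W k n ∅) := hom_ext_X fun b => by
    change (phi n i j).alg ((sect n i j).alg (X b)) = X b
    simp [sect, phi]
  exact DFunLike.congr_fun (congrArg Hom.alg this) a

theorem sect_psi (n : ℕ) (i j : Fin n) (a : W k n ∅) :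
    (psi n i j).alg ((sect n i j).alg a) = a := by
  have : sect n i j ≫ psi n i j = 𝟙 (W k n ∅) := hom_ext_X fun b => by
    change (psi n i j).alg ((sect n i j).alg (X b)) = X b
    simp [sect, psi]
  exact DFunLike.congr_fun (congrArg Hom.alg this) a

theorem sect_mul_last (n : ℕ) (i j : Fin n) (hij : i ≠ j) (c : W k n ∅)
    (h : c * (X i * X j) = 0) :
    (sect n i j).alg c * X (Fin.last n) = 0 := by
  obtain ⟨f, rfl⟩ : ∃ f, Ideal.Quotient.mk (Simplicial.relIdeal k n ∅) f = c :=
    Ideal.Quotient.mk_surjective c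
  have h' : f * (MvPolynomial.X i * MvPolynomial.X j) ∈ Simplicial.relIdeal k n ∅ :=
    Ideal.Quotient.eq_zero_iff_mem.1 h
  rw [Simplicial.mem_relIdeal] at h'
  have hmk : ∀ g : MvPolynomial (Fin n) k, (sect n i j).alg
      (Ideal.Quotient.mk (Simplicial.relIdeal k n ∅) g : W k n ∅) =
        MvPolynomial.aeval (fun a => (X a.castSucc : W k (n + 1) (lastRel n i j))) g :=
    fun g => rfl
  rw [hmk, f.as_sum, map_sum, Finset.sum_mul]
  refine Finset.sum_eq_zero fun m hm => ?_
  have hdvd : ∀ s : Fin n →₀ ℕ, s ≤ m → MvPolynomial.aeval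
      (fun a => (X a.castSucc : W k (n + 1) (lastRel n i j)))
        (MvPolynomial.monomial s (1 : k)) * X (Fin.last n) = 0 →
      MvPolynomial.aeval (fun a => (X a.castSucc : W k (n + 1) (lastRel n i j)))
        (MvPolynomial.monomial m (f.coeff m)) * X (Fin.last n) = 0 := by
    intro s hs h0
    have e : MvPolynomial.monomial m (f.coeff m) =
        MvPolynomial.monomial (m - s) (f.coeff m) * MvPolynomial.monomial s 1 := by
      rw [MvPolynomial.monomial_mul, tsub_add_cancel_of_le hs, mul_one]
    rw [e, map_mul, mul_assoc, h0, mul_zero]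
  have hX : ∀ a : Fin n, MvPolynomial.aeval
      (fun a => (X a.castSucc : W k (n + 1) (lastRel n i j)))
        (MvPolynomial.monomial (Finsupp.single a 1) (1 : k)) = X a.castSucc :=
    fun a => MvPolynomial.aeval_X _ a
  have hb := h' (m + (Finsupp.single i 1 + Finsupp.single j 1)) (by
    rw [MvPolynomial.mem_support_iff, MvPolynomial.X, MvPolynomial.X, MvPolynomial.monomial_mul,
      mul_one, MvPolynomial.coeff_mul_monomial, mul_one]
    exact MvPolynomial.mem_support_iff.1 hm)
  rcases hb with ⟨a, ha⟩ | ⟨a, ha, _⟩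
  · by_cases hi : m i = 0
    · by_cases hj : m j = 0
      · refine hdvd (Finsupp.single a 1 + Finsupp.single a 1) ?_ ?_
        · have h2 := ha a
          have hai : a ≠ i := by
            rintro rfl
            simp [hi, hij.symm] at h2
          have haj : a ≠ j := by
            rintro rfl
            simp [hj, hij] at h2
          intro b
          by_cases hab : a = b
          · subst hab
            simpa [hai.symm, haj.symm] using h2
          · simp [hab]
        · rw [← one_mul (1 : k), ← MvPolynomial.monomial_mul, map_mul, hX, X_sq, zero_mul]
      · refine hdvd (Finsupp.single j 1) ?_ ?_
        · simpa using Nat.one_le_iff_ne_zero.2 hj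
        · rw [hX, X_rel (by simp)]
    · refine hdvd (Finsupp.single i 1) ?_ ?_
      · simpa using Nat.one_le_iff_ne_zero.2 hi
      · rw [hX, X_rel (by simp)]
  · simp at ha

theorem exists_decomp (n : ℕ) (i j : Fin n) (t : W k (n + 1) (lastRel n i j)) :
    ∃ a c, t = (sect n i j).alg a + (sect n i j).alg c * X (Fin.last n) := by
  refine W_induction (P := fun t =>
    ∃ a c, t = (sect n i j).alg a + (sect n i j).alg c * X (Fin.last n)) t ?_ ?_ ?_
  · intro c
    exact ⟨algebraMap k _ c, 0, by simp⟩
  · rintro _ _ ⟨a, c, rfl⟩ ⟨a', c', rfl⟩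
    exact ⟨a + a', c + c', by rw [map_add, map_add]; ring⟩
  · rintro _ b ⟨a, c, rfl⟩
    induction b using Fin.lastCases with
    | last =>
      refine ⟨0, a, ?_⟩
      rw [add_mul, mul_assoc, X_sq, map_zero, mul_zero, add_zero, zero_add]
    | cast b =>
      refine ⟨a * X b, c * X b, ?_⟩
      have : (sect n i j).alg (X b) = (X b.castSucc : W k (n + 1) (lastRel n i j)) := by
        simp [sect]
      rw [map_mul, map_mul, this]
      ring

/-- `𝒲_{Dⁿ⁺¹{(i, n), (j, n)}}` is the kernel pair of `𝒲_{Dⁿ} ⟶ 𝒲_{Dⁿ{(i, j)}}`. -/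
theorem existsUnique_phi_psi (n : ℕ) (i j : Fin n) (hij : i ≠ j) (a b : W k n ∅)
    (h : (incl n i j).alg a = (incl n i j).alg b) :
    ∃! t, (phi n i j).alg t = a ∧ (psi n i j).alg t = b := by
  have hpl : (phi n i j).alg (X (Fin.last n) : W k _ _) = 0 := by simp [phi]
  have hql : (psi n i j).alg (X (Fin.last n) : W k _ _) = X i * X j := by simp [psi]
  obtain ⟨c, hc⟩ : ∃ c, b - a = c * (X i * X j) := by
    obtain ⟨f, hf⟩ : ∃ f, Ideal.Quotient.mk (Simplicial.relIdeal k n ∅) f = b - a :=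
      Ideal.Quotient.mk_surjective (b - a)
    have h0 : (incl n i j).alg (b - a) = 0 := by rw [map_sub, h, sub_self]
    rw [← hf] at h0
    have hmem : f ∈ Simplicial.relIdeal k n {(i, j)} := by
      have e : (incl n i j).alg (Ideal.Quotient.mk (Simplicial.relIdeal k n ∅) f : W k n ∅) =
          (Ideal.Quotient.mk (Simplicial.relIdeal k n {(i, j)}) f : W k n {(i, j)}) := by
        change MvPolynomial.aeval (fun a => (X a : W k n {(i, j)})) f =
          Ideal.Quotient.mkₐ k (Simplicial.relIdeal k n {(i, j)}) f
        congr 1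
        exact MvPolynomial.algHom_ext fun a => MvPolynomial.aeval_X _ a
      exact Ideal.Quotient.eq_zero_iff_mem.1 (e.symm.trans h0)
    have hle : Simplicial.relIdeal k n {(i, j)} ≤ Ideal.comap
        (Ideal.Quotient.mk (Simplicial.relIdeal k n ∅))
        (Ideal.span {Simplicial.x k i * Simplicial.x k j}) := by
      refine Ideal.span_le.2 ?_
      rintro g (⟨a, rfl⟩ | ⟨a, rfl, rfl⟩)
      · have : Ideal.Quotient.mk (Simplicial.relIdeal k n ∅)
            (MvPolynomial.X a * MvPolynomial.X a) = 0 := by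
          rw [map_mul]
          exact Simplicial.x_sq k a
        rw [SetLike.mem_coe, Ideal.mem_comap, this]
        exact zero_mem _
      · rw [SetLike.mem_coe, Ideal.mem_comap, map_mul]
        exact Ideal.subset_span rfl
    obtain ⟨c, hc⟩ := Ideal.mem_span_singleton'.1 (hle hmem)
    exact ⟨c, hf.symm.trans hc.symm⟩
  refine ⟨(sect n i j).alg a + (sect n i j).alg c * X (Fin.last n), ⟨?_, ?_⟩, ?_⟩
  · rw [map_add, map_mul, hpl, mul_zero, add_zero, sect_phi]
  · rw [map_add, map_mul, hql, sect_psi, sect_psi, ← hc, add_sub_cancel]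
  · rintro t ⟨h1, h2⟩
    obtain ⟨a', c', rfl⟩ := exists_decomp n i j t
    rw [map_add, map_mul, hpl, mul_zero, add_zero, sect_phi] at h1
    rw [map_add, map_mul, hql, sect_psi, sect_psi] at h2
    subst h1
    have h3 : (c' - c) * (X i * X j) = 0 := by rw [sub_mul, ← hc, ← h2]; ring
    have h4 := sect_mul_last n i j hij _ h3
    rw [map_sub, sub_mul, sub_eq_zero] at h4
    rw [h4]

/-- The mapping `(d₁, d₂) ↦ (d₁ in place l, d₂ in the last place, 0 elsewhere)` from `D²{p}` to
`D⁴{(i, 3), (j, 3)}`, where `i < j` are the two elements of `{0, 1, 2}` different from `l`. -/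
noncomputable def slot (p : Set (Fin 2 × Fin 2)) (l : Fin 3) :
    W k 4 (lastRel 3 (l.succAbove 0) (l.succAbove 1)) ⟶ W k 2 p :=
  ofMap (Fin.snoc (α := fun _ => W k 2 p) (Pi.single l (X 0)) (X 1))
    (fun a => by
      induction a using Fin.lastCases with
      | last => rw [Fin.snoc_last, X_sq]
      | cast a =>
        rcases eq_or_ne a l with rfl | h
        · simp [X_sq]
        · simp [h])
    (by rintro a b (h | h) <;> obtain ⟨rfl, rfl⟩ := Prod.ext_iff.1 h <;> simp)
    (fun a => by
      induction a using Fin.lastCases with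
      | last => rw [Fin.snoc_last, aug_X]
      | cast a =>
        rcases eq_or_ne a l with rfl | h
        · simp
        · simp [h])

theorem slot_incl (l : Fin 3) :
    (slot ∅ l : W k _ _ ⟶ _) ≫ incl 2 0 1 = slot {(0, 1)} l := by
  refine hom_ext_X fun a => ?_
  change (incl 2 0 1).alg ((slot ∅ l).alg (X a)) = (slot {(0, 1)} l).alg (X a)
  induction a using Fin.lastCases with
  | last => simp only [slot, incl, ofMap_X, Fin.snoc_last]
  | cast a =>
    rcases eq_or_ne a l with rfl | h
    · simp [slot, incl]
    · simp [slot, h]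

/-- The mapping `D → D³{(0, 2), (1, 2)}, d ↦ (0, 0, d)`. -/
noncomputable def lastAxis : W k 3 (lastRel 2 0 1) ⟶ W k 1 ∅ :=
  ofMap ![0, 0, X 0] (by simp [Fin.forall_fin_succ, X_sq])
    (by rintro a b (h | h) <;> obtain ⟨rfl, rfl⟩ := Prod.ext_iff.1 h <;> exact zero_mul _)
    (by simp [Fin.forall_fin_succ])

/-- The mapping `D → D(2), d ↦ (d, 0)`. -/
noncomputable def axis₁ : W k 2 {(0, 1)} ⟶ W k 1 ∅ :=
  ofMap ![X 0, 0] (by simp [Fin.forall_fin_two, X_sq])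
    (by rintro a b h; obtain ⟨rfl, rfl⟩ := Prod.ext_iff.1 h; simp) (by simp [Fin.forall_fin_two])

/-- The mapping `D → D(2), d ↦ (0, d)`. -/
noncomputable def axis₂ : W k 2 {(0, 1)} ⟶ W k 1 ∅ :=
  ofMap ![0, X 0] (by simp [Fin.forall_fin_two, X_sq])
    (by rintro a b h; obtain ⟨rfl, rfl⟩ := Prod.ext_iff.1 h; simp) (by simp [Fin.forall_fin_two])

/-- The mapping `D → D(2), d ↦ (d, d)`. -/
noncomputable def diag : W k 2 {(0, 1)} ⟶ W k 1 ∅ :=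
  ofMap ![X 0, X 0] (by simp [Fin.forall_fin_two, X_sq])
    (by rintro a b h; obtain ⟨rfl, rfl⟩ := Prod.ext_iff.1 h; simp [X_sq])
    (by simp [Fin.forall_fin_two])

@[simp] theorem comp_toBase {W V : WeilAlg k} (f : W ⟶ V) : f ≫ V.toBase = W.toBase :=
  hom_ext f.aug_comp

/-- `𝒲_{D(2)}` is the fibre product of two copies of `𝒲_D` over `k`. -/
theorem existsUnique_axis (a b : W k 1 ∅) (h : (W k 1 ∅).toBase.alg a = (W k 1 ∅).toBase.alg b) :
    ∃! t : W k 2 {(0, 1)}, axis₁.alg t = a ∧ axis₂.alg t = b := by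
  change (W k 1 ∅).aug a = (W k 1 ∅).aug b at h
  let s₁ : W k 1 ∅ ⟶ W k 2 {(0, 1)} := ofMap (fun _ => X 0) (fun _ => X_sq _) (by simp)
    (fun _ => aug_X _)
  let s₂ : W k 1 ∅ ⟶ W k 2 {(0, 1)} := ofMap (fun _ => X 1) (fun _ => X_sq _) (by simp)
    (fun _ => aug_X _)
  have hs₁ : ∀ i, s₁.alg (X i) = X 0 := fun i => ofMap_X _ _ _ _ i
  have hs₂ : ∀ i, s₂.alg (X i) = X 1 := fun i => ofMap_X _ _ _ _ i
  have a1 : axis₁.alg (X 0 : W k 2 {(0, 1)}) = X 0 := by simp [axis₁]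
  have a1' : axis₁.alg (X 1 : W k 2 {(0, 1)}) = 0 := by simp [axis₁]
  have a2 : axis₂.alg (X 0 : W k 2 {(0, 1)}) = 0 := by simp [axis₂]
  have a2' : axis₂.alg (X 1 : W k 2 {(0, 1)}) = X 0 := by simp [axis₂]
  have h11 : ∀ a, axis₁.alg (s₁.alg a) = a := fun a => by
    have : s₁ ≫ axis₁ = 𝟙 (W k 1 ∅) := hom_ext_X fun i => by
      change axis₁.alg (s₁.alg (X i)) = X i
      rw [hs₁, a1, Fin.fin_one_eq_zero i]
    exact DFunLike.congr_fun (congrArg Hom.alg this) a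
  have h22 : ∀ a, axis₂.alg (s₂.alg a) = a := fun a => by
    have : s₂ ≫ axis₂ = 𝟙 (W k 1 ∅) := hom_ext_X fun i => by
      change axis₂.alg (s₂.alg (X i)) = X i
      rw [hs₂, a2', Fin.fin_one_eq_zero i]
    exact DFunLike.congr_fun (congrArg Hom.alg this) a
  have h12 : ∀ a, axis₁.alg (s₂.alg a) = algebraMap k _ ((W k 1 ∅).aug a) := fun a => by
    refine W_induction (P := fun a => axis₁.alg (s₂.alg a) =
      algebraMap k _ ((W k 1 ∅).aug a)) a ?_ ?_ ?_
    · intro c; simp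
    · intro s t hs ht; rw [map_add, map_add, map_add, map_add, hs, ht]
    · intro t i _; rw [map_mul, map_mul, hs₂, a1', map_mul, aug_X, mul_zero, mul_zero, map_zero]
  have h21 : ∀ a, axis₂.alg (s₁.alg a) = algebraMap k _ ((W k 1 ∅).aug a) := fun a => by
    refine W_induction (P := fun a => axis₂.alg (s₁.alg a) =
      algebraMap k _ ((W k 1 ∅).aug a)) a ?_ ?_ ?_
    · intro c; simp
    · intro s t hs ht; rw [map_add, map_add, map_add, map_add, hs, ht]
    · intro t i _; rw [map_mul, map_mul, hs₁, a2, map_mul, aug_X, mul_zero, mul_zero, map_zero]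
  have m1 : ∀ a, s₁.alg a * X 1 = algebraMap k _ ((W k 1 ∅).aug a) * X 1 := fun a => by
    refine W_induction (P := fun a => s₁.alg a * X 1 =
      algebraMap k _ ((W k 1 ∅).aug a) * X 1) a ?_ ?_ ?_
    · intro c; simp
    · intro s t hs ht; rw [map_add, map_add, map_add, add_mul, add_mul, hs, ht]
    · intro t i _
      rw [map_mul, hs₁, mul_assoc, X_rel (by simp), map_mul, aug_X, mul_zero, mul_zero, map_zero,
        zero_mul]
  have m2 : ∀ a, s₂.alg a * X 0 = algebraMap k _ ((W k 1 ∅).aug a) * X 0 := fun a => by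
    refine W_induction (P := fun a => s₂.alg a * X 0 =
      algebraMap k _ ((W k 1 ∅).aug a) * X 0) a ?_ ?_ ?_
    · intro c; simp
    · intro s t hs ht; rw [map_add, map_add, map_add, add_mul, add_mul, hs, ht]
    · intro t i _
      rw [map_mul, hs₂, mul_assoc, mul_comm (X 1), X_rel (by simp), map_mul, aug_X, mul_zero,
        mul_zero, map_zero, zero_mul]
  have ha1 : ∀ t, (W k 1 ∅).aug (axis₁.alg t) = (W k 2 {(0, 1)}).aug t :=
    fun t => DFunLike.congr_fun axis₁.aug_comp t
  have ha2 : ∀ t, (W k 1 ∅).aug (axis₂.alg t) = (W k 2 {(0, 1)}).aug t :=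
    fun t => DFunLike.congr_fun axis₂.aug_comp t
  have hdec : ∀ t : W k 2 {(0, 1)}, t = s₁.alg (axis₁.alg t) + s₂.alg (axis₂.alg t) -
      algebraMap k _ ((W k 2 {(0, 1)}).aug t) := fun t => by
    refine W_induction (P := fun t => t = s₁.alg (axis₁.alg t) + s₂.alg (axis₂.alg t) -
      algebraMap k _ ((W k 2 {(0, 1)}).aug t)) t ?_ ?_ ?_
    · intro c; simp
    · intro s t hs ht
      simp only [map_add]
      nth_rewrite 1 [hs, ht]
      ring
    · intro t i ht
      fin_cases i
      · change t * X 0 = s₁.alg (axis₁.alg (t * X 0)) + s₂.alg (axis₂.alg (t * X 0)) -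
          algebraMap k _ ((W k 2 {(0, 1)}).aug (t * X 0))
        rw [map_mul, map_mul, map_mul, map_mul, map_mul, a1, a2, hs₁, map_zero, aug_X, mul_zero,
          mul_zero, map_zero, add_zero, sub_zero]
        nth_rewrite 1 [ht]
        rw [sub_mul, add_mul, m2, ha2]
        ring
      · change t * X 1 = s₁.alg (axis₁.alg (t * X 1)) + s₂.alg (axis₂.alg (t * X 1)) -
          algebraMap k _ ((W k 2 {(0, 1)}).aug (t * X 1))
        rw [map_mul, map_mul, map_mul, map_mul, map_mul, a1', a2', hs₂, map_zero, aug_X, mul_zero,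
          mul_zero, map_zero, zero_add, sub_zero]
        nth_rewrite 1 [ht]
        rw [sub_mul, add_mul, m1, ha1]
        ring
  refine ⟨s₁.alg a + s₂.alg b - algebraMap k _ ((W k 1 ∅).aug a), ⟨?_, ?_⟩, ?_⟩
  · rw [map_sub, map_add, h11, h12, AlgHom.commutes, h]
    ring
  · rw [map_sub, map_add, h21, h22, AlgHom.commutes]
    ring
  · rintro t ⟨rfl, rfl⟩
    rw [ha1]
    exact hdec t

end WeilAlg

/-! ## DG-categories -/

/-- A commutative `k`-algebra object `R` of a category: the sets `X ⟶ R` of generalized elements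
are commutative `k`-algebras, naturally in `X`. -/
class CommAlgObj (k : Type u) [CommRing k] {C : Type w} [Category.{v} C] (R : C) where
  commRing : ∀ X : C, CommRing (X ⟶ R)
  algebra : ∀ X : C, Algebra k (X ⟶ R)
  comp_add : ∀ {X Y : C} (f : X ⟶ Y) (a b : Y ⟶ R), f ≫ (a + b) = f ≫ a + f ≫ b
  comp_mul : ∀ {X Y : C} (f : X ⟶ Y) (a b : Y ⟶ R), f ≫ (a * b) = (f ≫ a) * (f ≫ b)
  comp_algebraMap : ∀ {X Y : C} (f : X ⟶ Y) (c : k),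
    f ≫ algebraMap k (Y ⟶ R) c = algebraMap k (X ⟶ R) c

namespace CommAlgObj

variable (k : Type u) [CommRing k] {C : Type w} [Category.{v} C] {R : C} [CommAlgObj k R]

attribute [reducible] commRing algebra

/-- Precomposition with `f`, as a homomorphism of `k`-algebras. -/
def precomp {X Y : C} (f : X ⟶ Y) :
    letI := commRing k (R := R)
    letI := algebra (k := k) (R := R)
    (Y ⟶ R) →ₐ[k] (X ⟶ R) :=
  letI := commRing k (R := R)
  letI := algebra (k := k) (R := R)
  { toFun := fun a => f ≫ a
    map_one' := by simpa using comp_algebraMap (R := R) f (1 : k)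
    map_mul' := comp_mul (k := k) f
    map_zero' := by simpa using comp_algebraMap (R := R) f (0 : k)
    map_add' := comp_add (k := k) f
    commutes' := comp_algebraMap f }

end CommAlgObj

/-- A DG-category `(C, R, T, α)` over `k`. The functor `T` packages the Weil functors
`T^W : C ⥤ C`, written `M ↦ M ⊗ W`, together with the natural transformations
`α_φ : T^W ⟶ T^V`, written `id_M ⊗ φ`, for `φ : W ⟶ V`. The identities `T^k = id`,
`T^V ∘ T^W = T^{W ⊗ V}` and `T^W R = R ⊗ W` are coherent natural isomorphisms. -/
structure DGCategory (k : Type u) [CommRing k] (C : Type w) [Category.{v} C]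
    [HasFiniteLimits C] where
  R : C
  [algObj : CommAlgObj k R]
  T : WeilAlg k ⥤ C ⥤ C
  /-- Each `T^W` is left exact. -/
  leftExact : ∀ W, PreservesFiniteLimits (T.obj W)
  unitIso : T.obj (WeilAlg.base k) ≅ 𝟭 C
  mulIso : ∀ W V, T.obj W ⋙ T.obj V ≅ T.obj (W.tensor V)
  mulIso_natural : ∀ {W W' V V' : WeilAlg k} (f : W ⟶ W') (g : V ⟶ V') (M : C),
    (T.obj V).map ((T.map f).app M) ≫ (T.map g).app ((T.obj W').obj M) ≫
      (mulIso W' V').hom.app M = (mulIso W V).hom.app M ≫ (T.map (WeilAlg.tensorMap f g)).app M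
  mulIso_assoc : ∀ (U V W : WeilAlg k) (M : C),
    (T.obj W).map ((mulIso U V).hom.app M) ≫ (mulIso (U.tensor V) W).hom.app M ≫
      (T.map (WeilAlg.assoc U V W)).app M =
    (mulIso V W).hom.app ((T.obj U).obj M) ≫ (mulIso U (V.tensor W)).hom.app M
  mulIso_lid : ∀ (W : WeilAlg k) (M : C),
    (mulIso (WeilAlg.base k) W).hom.app M ≫ (T.map W.lid).app M =
      (T.obj W).map (unitIso.hom.app M)
  mulIso_rid : ∀ (W : WeilAlg k) (M : C),
    (mulIso W (WeilAlg.base k)).hom.app M ≫ (T.map W.rid).app M =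
      unitIso.hom.app ((T.obj W).obj M)
  /-- `T^W R` is `R ⊗ W`, the object whose generalized elements at `X` are those of
  `(X ⟶ R) ⊗ W`. -/
  scalarEquiv : ∀ (W : WeilAlg k) (X : C),
    letI := CommAlgObj.commRing k (R := R)
    letI := CommAlgObj.algebra (k := k) (R := R)
    (X ⟶ (T.obj W).obj R) ≃ (X ⟶ R) ⊗[k] W
  scalarEquiv_comp : ∀ (W : WeilAlg k) {X Y : C} (f : X ⟶ Y) (a : Y ⟶ (T.obj W).obj R),
    letI := CommAlgObj.commRing k (R := R)
    letI := CommAlgObj.algebra (k := k) (R := R)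
    scalarEquiv W X (f ≫ a) =
      Algebra.TensorProduct.map (CommAlgObj.precomp k f) (AlgHom.id k W) (scalarEquiv W Y a)
  scalarEquiv_unit : ∀ {X : C} (a : X ⟶ (T.obj (WeilAlg.base k)).obj R),
    letI := CommAlgObj.commRing k (R := R)
    letI := CommAlgObj.algebra (k := k) (R := R)
    scalarEquiv (WeilAlg.base k) X a =
      TensorProduct.tmul k (M := X ⟶ R) (N := k) (a ≫ unitIso.hom.app R) 1
  /-- The `k`-algebra structure that the left exact functor `T^W` transports to `T^W R` is that of
  `R ⊗ W`. -/
  scalarEquiv_alg : ∀ (W : WeilAlg k) {X Y : C} (z : X ⟶ (T.obj W).obj Y),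
    letI := CommAlgObj.commRing k (R := R)
    letI := CommAlgObj.algebra (k := k) (R := R)
    ∃ h : (Y ⟶ R) →ₐ[k] (X ⟶ R) ⊗[k] W, ∀ f : Y ⟶ R,
      h f = scalarEquiv W X (z ≫ (T.obj W).map f)
  /-- `α_φ(R) = R ⊗ φ`. -/
  scalarEquiv_map : ∀ {W V : WeilAlg k} (φ : W ⟶ V) {X : C} (a : X ⟶ (T.obj W).obj R),
    letI := CommAlgObj.commRing k (R := R)
    letI := CommAlgObj.algebra (k := k) (R := R)
    scalarEquiv V X (a ≫ (T.map φ).app R) =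
      Algebra.TensorProduct.map (AlgHom.id k (X ⟶ R)) φ.alg (scalarEquiv W X a)

namespace DGCategory

open WeilAlg

variable {k : Type u} [CommRing k] {C : Type w} [Category.{v} C] [HasFiniteLimits C]
  (𝓓 : DGCategory k C)

/-- The object `M ⊗ W`. -/
abbrev tens (M : C) (W : WeilAlg k) : C := (𝓓.T.obj W).obj M

/-- The morphism `id_M ⊗ φ : M ⊗ W ⟶ M ⊗ V`. -/
abbrev tmap (M : C) {W V : WeilAlg k} (φ : W ⟶ V) : 𝓓.tens M W ⟶ 𝓓.tens M V := (𝓓.T.map φ).app M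

/-- The functor `M ⊗ - : WeilAlg k ⥤ C`. -/
abbrev tensFunctor (M : C) : WeilAlg k ⥤ C := 𝓓.T.flip.obj M

/-- `M` is microlinear if `M ⊗ -` turns every finite diagram of Weil algebras with a cone that is
a limit cone of `k`-algebras into a limit diagram in `C`. -/
def Microlinear (M : C) : Prop :=
  ∀ (J : Type) [SmallCategory J] [FinCategory J] (F : J ⥤ WeilAlg k) (c : Cone F),
    Nonempty (IsLimit ((toAlg k).mapCone c)) → Nonempty (IsLimit ((𝓓.tensFunctor M).mapCone c))

/-- `E` with `ev : X × E ⟶ B` is an exponential object `B ^ X`. -/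
def IsExponential {X B E : C} (ev : X ⨯ E ⟶ B) : Prop :=
  ∀ (Y : C) (f : X ⨯ Y ⟶ B), ∃! g : Y ⟶ E, prod.map (𝟙 X) g ≫ ev = f

/-- The canonical morphism `X × (E ⊗ V) ⟶ (X × E) ⊗ V`. -/
noncomputable def strength (X E : C) (V : WeilAlg k) : X ⨯ 𝓓.tens E V ⟶ 𝓓.tens (X ⨯ E) V :=
  haveI := 𝓓.leftExact V
  prod.map (𝓓.unitIso.inv.app X ≫ 𝓓.tmap X V.unit) (𝟙 _) ≫
    (PreservesLimitPair.iso (𝓓.T.obj V) X E).inv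

/-- `M` is Weil-exponentiable if `(M ⊗ (W ⊗ V)) ^ X = ((M ⊗ W) ^ X) ⊗ V` for every object `X` and
all Weil algebras `W` and `V`: the exponential `(M ⊗ W) ^ X` exists, and the object
`((M ⊗ W) ^ X) ⊗ V` with the canonical evaluation is an exponential `(M ⊗ (W ⊗ V)) ^ X`. -/
def WeilExponentiable (M : C) : Prop :=
  ∀ (X : C) (W : WeilAlg k), ∃ (E : C) (ev : X ⨯ E ⟶ 𝓓.tens M W), IsExponential ev ∧
    ∀ V : WeilAlg k,
      IsExponential (𝓓.strength X E V ≫ (𝓓.T.obj V).map ev ≫ (𝓓.mulIso W V).hom.app M)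

variable (M : C)

/-- The projection `M ⊗ W ⟶ M`. -/
noncomputable def base (W : WeilAlg k) : 𝓓.tens M W ⟶ M :=
  𝓓.tmap M W.toBase ≫ 𝓓.unitIso.hom.app M

/-- The zero section `M ⟶ M ⊗ 𝒲_D`. -/
noncomputable def zeroSection : M ⟶ 𝓓.tens M (W k 1 ∅) :=
  𝓓.unitIso.inv.app M ≫ 𝓓.tmap M (W k 1 ∅).unit

theorem tmap_comp {U V W : WeilAlg k} (f : U ⟶ V) (g : V ⟶ W) :
    𝓓.tmap M f ≫ 𝓓.tmap M g = 𝓓.tmap M (f ≫ g) := by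
  simp [tmap]

theorem tmap_base {V W : WeilAlg k} (f : V ⟶ W) : 𝓓.tmap M f ≫ 𝓓.base M W = 𝓓.base M V := by
  rw [base, ← Category.assoc, tmap_comp, comp_toBase, base]

variable {M}

/-- A fibre product of Weil algebras is turned into a fibre product by a microlinear object. -/
theorem Microlinear.isPullback (hM : 𝓓.Microlinear M) {P A B Z : WeilAlg k} (f₁ : P ⟶ A)
    (f₂ : P ⟶ B) (g₁ : A ⟶ Z) (g₂ : B ⟶ Z) (w : f₁ ≫ g₁ = f₂ ≫ g₂)
    (h : ∀ a b, g₁.alg a = g₂.alg b → ∃! t, f₁.alg t = a ∧ f₂.alg t = b) :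
    IsPullback (𝓓.tmap M f₁) (𝓓.tmap M f₂) (𝓓.tmap M g₁) (𝓓.tmap M g₂) := by
  have halg : IsLimit (PullbackCone.mk ((toAlg k).map f₁) ((toAlg k).map f₂)
      (by rw [← Functor.map_comp, w, Functor.map_comp]) :
      PullbackCone ((toAlg k).map g₁) ((toAlg k).map g₂)) := by
    refine PullbackCone.IsLimit.mk _ (fun s => ?_) ?_ ?_ ?_
    · have hs : ∀ x, g₁.alg (s.fst.hom x) = g₂.alg (s.snd.hom x) := fun x =>
        DFunLike.congr_fun (congrArg CommAlgCat.Hom.hom s.condition) x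
      have hc := fun x => (h _ _ (hs x)).choose_spec.1
      have hu : ∀ x t, f₁.alg t = s.fst.hom x → f₂.alg t = s.snd.hom x →
          (h _ _ (hs x)).choose = t := fun x t h1 h2 => ((h _ _ (hs x)).unique (hc x) ⟨h1, h2⟩)
      exact CommAlgCat.ofHom (X := s.pt) (Y := P)
        { toFun := fun x => (h _ _ (hs x)).choose
          map_one' := hu _ _ (by simp; rfl) (by simp; rfl)
          map_mul' := fun x y => hu _ _
            (by rw [map_mul, map_mul, (hc x).1, (hc y).1]; rfl)
            (by rw [map_mul, map_mul, (hc x).2, (hc y).2]; rfl)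
          map_zero' := hu _ _ (by simp; rfl) (by simp; rfl)
          map_add' := fun x y => hu _ _
            (by rw [map_add, map_add, (hc x).1, (hc y).1]; rfl)
            (by rw [map_add, map_add, (hc x).2, (hc y).2]; rfl)
          commutes' := fun c => hu _ _ (by simp; rfl) (by simp; rfl) }
    · intro s
      have hs : ∀ x, g₁.alg (s.fst.hom x) = g₂.alg (s.snd.hom x) := fun x =>
        DFunLike.congr_fun (congrArg CommAlgCat.Hom.hom s.condition) x
      exact CommAlgCat.hom_ext (AlgHom.ext fun x => (h _ _ (hs x)).choose_spec.1.1)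
    · intro s
      have hs : ∀ x, g₁.alg (s.fst.hom x) = g₂.alg (s.snd.hom x) := fun x =>
        DFunLike.congr_fun (congrArg CommAlgCat.Hom.hom s.condition) x
      exact CommAlgCat.hom_ext (AlgHom.ext fun x => (h _ _ (hs x)).choose_spec.1.2)
    · intro s m h1 h2
      have hs : ∀ x, g₁.alg (s.fst.hom x) = g₂.alg (s.snd.hom x) := fun x =>
        DFunLike.congr_fun (congrArg CommAlgCat.Hom.hom s.condition) x
      refine CommAlgCat.hom_ext (AlgHom.ext fun x =>
        (h _ _ (hs x)).unique ⟨?_, ?_⟩ (h _ _ (hs x)).choose_spec.1)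
      · exact DFunLike.congr_fun (congrArg CommAlgCat.Hom.hom h1) x
      · exact DFunLike.congr_fun (congrArg CommAlgCat.Hom.hom h2) x
  obtain ⟨hl⟩ := hM WalkingCospan (cospan g₁ g₂) (PullbackCone.mk f₁ f₂ w)
    ⟨(isLimitMapConePullbackConeEquiv (toAlg k) w).symm halg⟩
  exact ⟨⟨by rw [tmap_comp, w, tmap_comp]⟩,
    ⟨isLimitMapConePullbackConeEquiv (𝓓.tensFunctor M) w hl⟩⟩

/-! ### Strong differences -/

/-- The fibre product `(M ⊗ 𝒲_{Dⁿ}) ×_{M ⊗ 𝒲_{Dⁿ{(i, j)}}} (M ⊗ 𝒲_{Dⁿ})`. -/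
noncomputable abbrev Pair (M : C) (n : ℕ) (i j : Fin n) : C :=
  pullback (𝓓.tmap M (incl n i j)) (𝓓.tmap M (incl n i j))

/-- The comparison morphism from `M ⊗ 𝒲_{Dⁿ⁺¹{(i, n), (j, n)}}` to that fibre product. -/
noncomputable def toPair (M : C) (n : ℕ) (i j : Fin n) :
    𝓓.tens M (W k (n + 1) (lastRel n i j)) ⟶ 𝓓.Pair M n i j :=
  pullback.lift (𝓓.tmap M (phi n i j)) (𝓓.tmap M (psi n i j))
    (by rw [tmap_comp, phi_incl, tmap_comp])

theorem Microlinear.isIso_toPair (hM : 𝓓.Microlinear M) {n : ℕ} {i j : Fin n} (hij : i ≠ j) :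
    IsIso (𝓓.toPair M n i j) := by
  have h := Microlinear.isPullback 𝓓 hM (phi n i j) (psi n i j) (incl n i j) (incl n i j)
    (phi_incl n i j) (existsUnique_phi_psi n i j hij)
  have e : 𝓓.toPair M n i j = h.isoPullback.hom := by
    apply pullback.hom_ext
    · rw [IsPullback.isoPullback_hom_fst]; exact pullback.lift_fst _ _ _
    · rw [IsPullback.isoPullback_hom_snd]; exact pullback.lift_snd _ _ _
  rw [e]
  infer_instance

/-- The identification of that fibre product with `M ⊗ 𝒲_{Dⁿ⁺¹{(i, n), (j, n)}}`. -/
noncomputable def pairIso (hM : 𝓓.Microlinear M) {n : ℕ} {i j : Fin n} (hij : i ≠ j) :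
    𝓓.Pair M n i j ≅ 𝓓.tens M (W k (n + 1) (lastRel n i j)) :=
  haveI := Microlinear.isIso_toPair 𝓓 hM hij
  (asIso (𝓓.toPair M n i j)).symm

/-- The strong difference `ζ : (M ⊗ 𝒲_{D²}) ×_{M ⊗ 𝒲_{D(2)}} (M ⊗ 𝒲_{D²}) ⟶ M ⊗ 𝒲_D`
(second factor minus first factor). -/
noncomputable def zeta (hM : 𝓓.Microlinear M) : 𝓓.Pair M 2 0 1 ⟶ 𝓓.tens M (W k 1 ∅) :=
  (𝓓.pairIso hM (zero_ne_one' (Fin 2))).hom ≫ 𝓓.tmap M lastAxis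

theorem succAbove_ne (l : Fin 3) : l.succAbove 0 ≠ l.succAbove 1 := by
  simp

/-- The fibre product `(M ⊗ 𝒲_{D³}) ×_{M ⊗ 𝒲_{D³{(i, j)}}} (M ⊗ 𝒲_{D³})`, where `i < j` are the
two elements of `{0, 1, 2}` different from `l`. -/
noncomputable abbrev Pair₃ (M : C) (l : Fin 3) : C :=
  𝓓.Pair M 3 (l.succAbove 0) (l.succAbove 1)

/-- The relative strong difference `ζ_l : (M ⊗ 𝒲_{D³}) ×_{M ⊗ 𝒲_{D³{(i, j)}}} (M ⊗ 𝒲_{D³}) ⟶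
M ⊗ 𝒲_{D²}` in the two directions `i`, `j` different from `l`. -/
noncomputable def zetaRel (hM : 𝓓.Microlinear M) (l : Fin 3) :
    𝓓.Pair₃ M l ⟶ 𝓓.tens M (W k 2 ∅) :=
  (𝓓.pairIso hM (succAbove_ne l)).hom ≫ 𝓓.tmap M (slot ∅ l)

/-- The morphism `(M ⊗ 𝒲_{D³}) ×_{M ⊗ 𝒲_{D³{(i, j)}}} (M ⊗ 𝒲_{D³}) ⟶ M ⊗ 𝒲_{D(2)}` along which
the outer fibre products are formed. -/
noncomputable def toD2 (hM : 𝓓.Microlinear M) (l : Fin 3) :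
    𝓓.Pair₃ M l ⟶ 𝓓.tens M (W k 2 {(0, 1)}) :=
  (𝓓.pairIso hM (succAbove_ne l)).hom ≫ 𝓓.tmap M (slot {(0, 1)} l)

theorem zetaRel_incl (hM : 𝓓.Microlinear M) (l : Fin 3) :
    𝓓.zetaRel hM l ≫ 𝓓.tmap M (incl 2 0 1) = 𝓓.toD2 hM l := by
  rw [zetaRel, toD2, Category.assoc, tmap_comp, slot_incl]

/-! ### The hexagon -/

/-- The object `Pair₃ l ×_{M ⊗ 𝒲_{D(2)}} Pair₃ l`, made of four copies of `M ⊗ 𝒲_{D³}`. The four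
copies are labelled, from left to right, by the permutations
* `321, 231, 132, 123` for `l = 0`;
* `132, 312, 213, 231` for `l = 1`;
* `213, 123, 321, 312` for `l = 2`. -/
noncomputable abbrev Quad (hM : 𝓓.Microlinear M) (l : Fin 3) : C :=
  pullback (𝓓.toD2 hM l) (𝓓.toD2 hM l)

section
variable (hM : 𝓓.Microlinear M) (l : Fin 3)

/-- The first canonical projection of `Quad l`. -/
noncomputable def proj₁ : 𝓓.Quad hM l ⟶ 𝓓.tens M (W k 3 ∅) := pullback.fst _ _ ≫ pullback.fst _ _

/-- The second canonical projection of `Quad l`. -/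
noncomputable def proj₂ : 𝓓.Quad hM l ⟶ 𝓓.tens M (W k 3 ∅) := pullback.fst _ _ ≫ pullback.snd _ _

/-- The third canonical projection of `Quad l`. -/
noncomputable def proj₃ : 𝓓.Quad hM l ⟶ 𝓓.tens M (W k 3 ∅) := pullback.snd _ _ ≫ pullback.fst _ _

/-- The fourth canonical projection of `Quad l`. -/
noncomputable def proj₄ : 𝓓.Quad hM l ⟶ 𝓓.tens M (W k 3 ∅) := pullback.snd _ _ ≫ pullback.snd _ _

theorem pair_fst_base : (pullback.fst _ _ : 𝓓.Pair₃ M l ⟶ _) ≫ 𝓓.base M _ =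
    (pullback.snd _ _ : 𝓓.Pair₃ M l ⟶ _) ≫ 𝓓.base M _ := by
  rw [← tmap_base 𝓓 M (incl 3 (l.succAbove 0) (l.succAbove 1)), ← Category.assoc,
    pullback.condition, Category.assoc]

theorem toD2_base : 𝓓.toD2 hM l ≫ 𝓓.base M _ = pullback.fst _ _ ≫ 𝓓.base M _ := by
  rw [toD2, Category.assoc, tmap_base, ← tmap_base 𝓓 M (phi 3 (l.succAbove 0) (l.succAbove 1)),
    ← Category.assoc]
  congr 1
  rw [← Iso.eq_inv_comp]
  exact (pullback.lift_fst _ _ _).symm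

theorem proj_base₁₂ : 𝓓.proj₁ hM l ≫ 𝓓.base M _ = 𝓓.proj₂ hM l ≫ 𝓓.base M _ := by
  rw [proj₁, proj₂, Category.assoc, Category.assoc, pair_fst_base]

theorem proj_base₃₄ : 𝓓.proj₃ hM l ≫ 𝓓.base M _ = 𝓓.proj₄ hM l ≫ 𝓓.base M _ := by
  rw [proj₃, proj₄, Category.assoc, Category.assoc, pair_fst_base]

theorem proj_base₁₃ : 𝓓.proj₁ hM l ≫ 𝓓.base M _ = 𝓓.proj₃ hM l ≫ 𝓓.base M _ := by
  rw [proj₁, proj₃, Category.assoc, Category.assoc, ← toD2_base 𝓓 hM, ← Category.assoc,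
    pullback.condition, Category.assoc]

/-- The fibre product `(M ⊗ 𝒲_{D³}) ×_M (M ⊗ 𝒲_{D³})`. -/
noncomputable abbrev Prod₃ (M : C) : C := pullback (𝓓.base M (W k 3 ∅)) (𝓓.base M (W k 3 ∅))

/-- The canonical projection of `Quad l` to its second and third factors. -/
noncomputable def proj₂₃ : 𝓓.Quad hM l ⟶ 𝓓.Prod₃ M :=
  pullback.lift (𝓓.proj₂ hM l) (𝓓.proj₃ hM l) (by rw [← proj_base₁₂, proj_base₁₃])

/-- The canonical projection of `Quad l` to its fourth and first factors. -/
noncomputable def proj₄₁ : 𝓓.Quad hM l ⟶ 𝓓.Prod₃ M :=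
  pullback.lift (𝓓.proj₄ hM l) (𝓓.proj₁ hM l) (by rw [← proj_base₃₄, proj_base₁₃])

end

/-- The hexagonal diagram `Quad 0 ⟶ · ⟵ Quad 1 ⟶ · ⟵ Quad 2 ⟶ · ⟵ Quad 0` in which each `·` is
`(M ⊗ 𝒲_{D³}) ×_M (M ⊗ 𝒲_{D³})`, with the canonical projections onto the two copies of `M ⊗ 𝒲_{D³}`
labelled `231, 132` (for `Quad 0` and `Quad 1`), `312, 213` (for `Quad 1` and `Quad 2`) and
`123, 321` (for `Quad 2` and `Quad 0`). -/
noncomputable def hexagon (hM : 𝓓.Microlinear M) :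
    MulticospanIndex { L := Fin 3, R := Fin 3, fst := id, snd := fun l => l + 1 } C where
  left := 𝓓.Quad hM
  right _ := 𝓓.Prod₃ M
  fst l := 𝓓.proj₂₃ hM l
  snd l := 𝓓.proj₄₁ hM (l + 1)

instance (hM : 𝓓.Microlinear M) : HasMultiequalizer (𝓓.hexagon hM) := by
  have : Fintype (MulticospanShape.L { L := Fin 3, R := Fin 3, fst := id, snd := fun l => l + 1 }) :=
    inferInstanceAs (Fintype (Fin 3))
  have : Fintype (MulticospanShape.R { L := Fin 3, R := Fin 3, fst := id, snd := fun l => l + 1 }) :=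
    inferInstanceAs (Fintype (Fin 3))
  classical
  infer_instance

/-- The limit of the hexagonal diagram. -/
noncomputable abbrev Hexagon (hM : 𝓓.Microlinear M) : C := multiequalizer (𝓓.hexagon hM)

/-- The morphism `ζ_l ×_{M ⊗ 𝒲_{D(2)}} ζ_l`. -/
noncomputable def zetaRelPair (hM : 𝓓.Microlinear M) (l : Fin 3) :
    𝓓.Quad hM l ⟶ 𝓓.Pair M 2 0 1 :=
  pullback.lift (pullback.fst _ _ ≫ 𝓓.zetaRel hM l) (pullback.snd _ _ ≫ 𝓓.zetaRel hM l)
    (by rw [Category.assoc, Category.assoc, zetaRel_incl, pullback.condition])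

/-- The three iterated strong differences: with the labels above (and `-ₗ` for the relative strong
difference in the `l`-th sense, `l = 0, 1, 2`) they are
* `(123 -₀ 132) - (231 -₀ 321)`;
* `(231 -₁ 213) - (312 -₁ 132)`;
* `(312 -₂ 321) - (123 -₂ 213)`. -/
noncomputable def iteratedZeta (hM : 𝓓.Microlinear M) (l : Fin 3) :
    𝓓.Hexagon hM ⟶ 𝓓.tens M (W k 1 ∅) :=
  Multiequalizer.ι (𝓓.hexagon hM) l ≫ 𝓓.zetaRelPair hM l ≫ 𝓓.zeta hM

/-! ### Addition of tangent vectors -/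

theorem Microlinear.isPullback_axis (hM : 𝓓.Microlinear M) :
    IsPullback (𝓓.tmap M axis₁) (𝓓.tmap M axis₂) (𝓓.base M (W k 1 ∅)) (𝓓.base M (W k 1 ∅)) :=
  (Microlinear.isPullback 𝓓 hM axis₁ axis₂ (W k 1 ∅).toBase (W k 1 ∅).toBase
    (by rw [comp_toBase, comp_toBase]) existsUnique_axis).of_iso (Iso.refl _) (Iso.refl _)
      (Iso.refl _) (𝓓.unitIso.app M) (by simp) (by simp) (by simp [base]) (by simp [base])

/-- The identification `(M ⊗ 𝒲_D) ×_M (M ⊗ 𝒲_D) = M ⊗ 𝒲_{D(2)}`. -/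
noncomputable def sumIso (hM : 𝓓.Microlinear M) :
    pullback (𝓓.base M (W k 1 ∅)) (𝓓.base M (W k 1 ∅)) ≅ 𝓓.tens M (W k 2 {(0, 1)}) :=
  (Microlinear.isPullback_axis 𝓓 hM).isoPullback.symm

/-- The sum, fibrewise over `M`, of two morphisms to `M ⊗ 𝒲_D` with the same projection to `M`:
the composite `X ⟶ (M ⊗ 𝒲_D) ×_M (M ⊗ 𝒲_D) = M ⊗ 𝒲_{D(2)} ⟶ M ⊗ 𝒲_D`, the last morphism being
induced by `d ↦ (d, d)`. -/
noncomputable def add (hM : 𝓓.Microlinear M) {X : C} (a b : X ⟶ 𝓓.tens M (W k 1 ∅))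
    (h : a ≫ 𝓓.base M _ = b ≫ 𝓓.base M _) : X ⟶ 𝓓.tens M (W k 1 ∅) :=
  pullback.lift a b h ≫ (𝓓.sumIso hM).hom ≫ 𝓓.tmap M diag

end DGCategory

/-!
The six microcubes of the hexagon, listed as `321, 231, 213, 123, 132, 312`, form a cycle in which
neighbours agree on some `D³{(i, j)}`. Let `hex` be the algebra of six-tuples of elements of `𝒲_{D³}`
that satisfy these six agreements. An agreement on `D³{(i, j)}` is an equality of the coefficients of
all monomials not divisible by `Xᵢ Xⱼ`, so every condition that defines `hex` identifies two
coefficients; hence `hex` is a free module (`hexEquiv`) and a Weil algebra. It is a limit of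
`k`-algebras, and microlinearity lets the whole hexagonal limit `Δ` factor through `M ⊗ hex`
(`exists_hexagonLift`).

The iterated strong differences can then be formed in Weil algebras (`exists_corner_diff`): each
`Z_l` is the morphism `Δ ⟶ M ⊗ hex` followed by `M ⊗ z_l` for a morphism `z_l : hex ⟶ 𝒲_D`
(`exists_iteratedZeta_eq`). A strong difference subtracts the coefficients of the top monomials
(`top_slot`, `top_lastAxis`), so the linear coefficient of `z_l` is an alternating sum of the
coefficients of `X₀ X₁ X₂` in four of the six microcubes. The fibrewise addition adds linear
coefficients (`top_diag`), and in the sum over `l` each microcube enters once with each sign. An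
element of `𝒲_D` is determined by its augmentation and its linear coefficient (`ext_aug_top`), so the
sum of the `z_l` is the augmentation followed by the unit, which represents the zero section.
-/

/-! ### Coefficients of monomials -/

namespace Simplicial

variable {k : Type u} [CommRing k] {n : ℕ} {p : Set (Fin n × Fin n)}

/-- The coefficient of a monomial outside the ideal of relations, as a linear form on the
coordinate algebra of `Dⁿ{p}`. -/
noncomputable def coeff (m : Fin n →₀ ℕ) (hm : ¬ Bad p m) : Alg k n p →ₗ[k] k :=
  (Submodule.liftQ ((relIdeal k n p).restrictScalars k) (MvPolynomial.lcoeff k m) (fun f hf => by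
    by_contra h
    exact hm ((mem_relIdeal k).1 hf m (MvPolynomial.mem_support_iff.2 h)))).comp
    (Submodule.Quotient.restrictScalarsEquiv k (relIdeal k n p)).symm.toLinearMap

theorem coeff_mk (m : Fin n →₀ ℕ) (hm : ¬ Bad p m) (f : MvPolynomial (Fin n) k) :
    coeff m hm (Ideal.Quotient.mk (relIdeal k n p) f) = f.coeff m := rfl

theorem mk_eq_mk_iff {f g : MvPolynomial (Fin n) k} :
    Ideal.Quotient.mk (relIdeal k n p) f = Ideal.Quotient.mk (relIdeal k n p) g ↔
      ∀ m, ¬ Bad p m → f.coeff m = g.coeff m := by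
  rw [Ideal.Quotient.eq, mem_relIdeal]
  refine forall_congr' fun m => ?_
  rw [MvPolynomial.mem_support_iff, MvPolynomial.coeff_sub, not_imp_comm, sub_eq_zero]

/-- An element of the coordinate algebra of `Dⁿ{p}` amounts to an arbitrary family of coefficients
of the monomials outside the ideal of relations. -/
noncomputable def coeffEquiv (k : Type u) [CommRing k] (n : ℕ) (p : Set (Fin n × Fin n)) :
    Alg k n p ≃ₗ[k] ({m // ¬ Bad p m} → k) :=
  LinearEquiv.ofBijective (LinearMap.pi fun m => coeff m.1 m.2) <| by
    constructor
    · intro a b h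
      obtain ⟨f, rfl⟩ := Ideal.Quotient.mk_surjective a
      obtain ⟨g, rfl⟩ := Ideal.Quotient.mk_surjective b
      exact mk_eq_mk_iff.2 fun m hm => congrFun h ⟨m, hm⟩
    · intro c
      have : Finite {m // ¬ Bad p m} := (finite_not_bad p).to_subtype
      have := Fintype.ofFinite {m // ¬ Bad p m}
      refine ⟨Ideal.Quotient.mk _ (∑ m, MvPolynomial.monomial m.1 (c m)), funext fun m => ?_⟩
      classical
      change MvPolynomial.coeff m.1 (∑ m, MvPolynomial.monomial m.1 (c m)) = c m
      rw [MvPolynomial.coeff_sum]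
      simp [MvPolynomial.coeff_monomial, Subtype.coe_inj]

end Simplicial

namespace WeilAlg

open Simplicial

variable {k : Type u} [CommRing k]

section Monomials

variable {n : ℕ} {p : Set (Fin n × Fin n)}

theorem mk_monomial (m : Fin n →₀ ℕ) :
    (Ideal.Quotient.mk (relIdeal k n p) (MvPolynomial.monomial m 1) : W k n p) =
      ∏ i, X i ^ m i := by
  rw [MvPolynomial.monomial_eq, Finsupp.prod_fintype _ _ (by simp)]
  simp only [map_one, one_mul, map_prod, map_pow]
  rfl

theorem alg_monomial {V : WeilAlg k} (f : W k n p ⟶ V) (m : Fin n → ℕ) :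
    f.alg (∏ i, X i ^ m i) = ∏ i, f.alg (X i) ^ m i := by
  rw [map_prod]
  simp only [map_pow]

theorem linearMap_ext_monomial {N : Type*} [AddCommGroup N] [Module k N] {L L' : W k n p →ₗ[k] N}
    (h : ∀ m : Fin n → ℕ, L (∏ i, X i ^ m i) = L' (∏ i, X i ^ m i)) : L = L' := by
  have e : L.comp (Ideal.Quotient.mkₐ k (relIdeal k n p)).toLinearMap =
      L'.comp (Ideal.Quotient.mkₐ k (relIdeal k n p)).toLinearMap := by
    refine MvPolynomial.linearMap_ext fun m => LinearMap.ext_ring ?_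
    have := h m
    rw [← mk_monomial] at this
    exact this
  refine LinearMap.ext fun t => ?_
  obtain ⟨f, rfl⟩ := Ideal.Quotient.mk_surjective t
  exact LinearMap.congr_fun e f

theorem not_bad_one :
    ¬ Bad (∅ : Set (Fin n × Fin n)) (Finsupp.equivFunOnFinite.symm fun _ => 1) := by
  rintro (⟨i, h⟩ | ⟨a, ha, _⟩)
  · simpa using h i
  · exact ha

/-- The coefficient of the top monomial `X₀ ⋯ Xₙ₋₁` of `𝒲_{Dⁿ}`. -/
noncomputable def top (k : Type u) [CommRing k] (n : ℕ) : W k n ∅ →ₗ[k] k :=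
  coeff _ not_bad_one

theorem top_monomial (m : Fin n → ℕ) :
    top k n (∏ i, X i ^ m i) = if ∀ i, m i = 1 then 1 else 0 := by
  have h := mk_monomial (k := k) (p := ∅) (Finsupp.equivFunOnFinite.symm m)
  simp only [Finsupp.equivFunOnFinite_symm_apply_apply] at h
  rw [← h]
  refine (coeff_mk _ _ _).trans ?_
  classical
  rw [MvPolynomial.coeff_monomial]
  congr 1
  rw [EmbeddingLike.apply_eq_iff_eq, funext_iff]

theorem top_one_monomial (a : ℕ) : top k 1 (X 0 ^ a) = if a = 1 then 1 else 0 := by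
  simpa using top_monomial (k := k) ![a]

theorem top_one_algebraMap (c : k) : top k 1 (algebraMap k (W k 1 ∅) c) = 0 := by
  rw [Algebra.algebraMap_eq_smul_one, map_smul, ← pow_zero (X 0), top_one_monomial,
    if_neg zero_ne_one, smul_zero]

theorem top_two_monomial (a b : ℕ) :
    top k 2 (X 0 ^ a * X 1 ^ b) = if a = 1 ∧ b = 1 then 1 else 0 := by
  simpa [Fin.forall_fin_succ] using top_monomial (k := k) ![a, b]

theorem top_three_monomial (a b c : ℕ) :
    top k 3 (X 0 ^ a * X 1 ^ b * X 2 ^ c) = if a = 1 ∧ b = 1 ∧ c = 1 then 1 else 0 := by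
  simpa [Fin.forall_fin_succ, Fin.prod_univ_succ, mul_assoc] using
    top_monomial (k := k) ![a, b, c]

/-- An element of `𝒲_D` is determined by its value at `0` and its linear coefficient. -/
theorem ext_aug_top {a b : W k 1 ∅} (h0 : (W k 1 ∅).aug a = (W k 1 ∅).aug b)
    (h1 : top k 1 a = top k 1 b) : a = b := by
  have key : LinearMap.id (R := k) (M := W k 1 ∅) =
      (Algebra.linearMap k (W k 1 ∅)).comp (W k 1 ∅).aug.toLinearMap +
        (LinearMap.toSpanSingleton k (W k 1 ∅) (X 0)).comp (top k 1) := by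
    refine linearMap_ext_monomial fun m => ?_
    simp only [Fin.prod_univ_one, LinearMap.id_apply, LinearMap.add_apply, LinearMap.comp_apply,
      AlgHom.toLinearMap_apply, Algebra.linearMap_apply, LinearMap.toSpanSingleton_apply, map_pow,
      aug_X, top_one_monomial]
    obtain h | h | ⟨r, h⟩ : m 0 = 0 ∨ m 0 = 1 ∨ ∃ r, m 0 = r + 2 := by
      rcases m 0 with _ | _ | r <;> simp
    · simp [h]
    · simp [h]
    · have : (X 0 : W k 1 ∅) ^ (r + 2) = 0 := by rw [pow_add, pow_two, X_sq, mul_zero]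
      simp [h, this]
  have hk := fun t => LinearMap.congr_fun key t
  simp only [LinearMap.id_apply, LinearMap.add_apply, LinearMap.comp_apply,
      AlgHom.toLinearMap_apply] at hk
  rw [hk a, hk b, h0, h1]

end Monomials

/-! ### Top coefficients of strong differences and of sums -/

/-- The top coefficient of a relative strong difference is the difference of the top coefficients. -/
theorem top_slot (l : Fin 3) (t : W k 4 (lastRel 3 (l.succAbove 0) (l.succAbove 1))) :
    top k 2 ((slot ∅ l).alg t) =
      top k 3 ((psi 3 (l.succAbove 0) (l.succAbove 1)).alg t) -
        top k 3 ((phi 3 (l.succAbove 0) (l.succAbove 1)).alg t) := by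
  have key : (top k 2).comp (slot ∅ l).alg.toLinearMap =
      (top k 3).comp (psi 3 (l.succAbove 0) (l.succAbove 1)).alg.toLinearMap -
        (top k 3).comp (phi 3 (l.succAbove 0) (l.succAbove 1)).alg.toLinearMap := by
    refine linearMap_ext_monomial fun m => ?_
    simp only [LinearMap.sub_apply, LinearMap.comp_apply, AlgHom.toLinearMap_apply]
    rw [alg_monomial, alg_monomial, alg_monomial]
    -- Every monomial is mapped to a monomial or to zero, so that only exponents are compared.
    rw [Fin.prod_univ_castSucc (n := 3), Fin.prod_univ_castSucc (n := 3),
      Fin.prod_univ_castSucc (n := 3)]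
    simp only [slot, phi, psi, ofMap_X, Fin.snoc_castSucc, Fin.snoc_last]
    rw [Fin.prod_univ_three, Fin.prod_univ_three]
    generalize m (Fin.last 3) = d
    generalize m (Fin.castSucc 0) = a
    generalize m (Fin.castSucc 1) = b
    generalize m (Fin.castSucc 2) = c
    have hl : l = 0 ∨ l = 1 ∨ l = 2 := by fin_cases l <;> simp
    rcases hl with rfl | rfl | rfl
    · change top k 2 (X 0 ^ a * 0 ^ b * 0 ^ c * X 1 ^ d) =
        top k 3 (X 0 ^ a * X 1 ^ b * X 2 ^ c * (X 1 * X 2) ^ d) -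
          top k 3 (X 0 ^ a * X 1 ^ b * X 2 ^ c * 0 ^ d)
      rw [show (X 0 ^ a * X 1 ^ b * X 2 ^ c * (X 1 * X 2) ^ d : W k 3 ∅) =
        X 0 ^ a * X 1 ^ (b + d) * X 2 ^ (c + d) by ring]
      simp only [zero_pow_eq, mul_ite, ite_mul, mul_one, mul_zero, zero_mul,
        apply_ite (top k _), map_zero, top_two_monomial, top_three_monomial]
      split_ifs <;> first | (exfalso; omega) | simp
    · change top k 2 (0 ^ a * X 0 ^ b * 0 ^ c * X 1 ^ d) =
        top k 3 (X 0 ^ a * X 1 ^ b * X 2 ^ c * (X 0 * X 2) ^ d) -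
          top k 3 (X 0 ^ a * X 1 ^ b * X 2 ^ c * 0 ^ d)
      rw [show (X 0 ^ a * X 1 ^ b * X 2 ^ c * (X 0 * X 2) ^ d : W k 3 ∅) =
        X 0 ^ (a + d) * X 1 ^ b * X 2 ^ (c + d) by ring]
      simp only [zero_pow_eq, mul_ite, ite_mul, mul_one, one_mul, mul_zero, zero_mul,
        apply_ite (top k _), map_zero, top_two_monomial, top_three_monomial]
      split_ifs <;> first | (exfalso; omega) | simp
    · change top k 2 (0 ^ a * 0 ^ b * X 0 ^ c * X 1 ^ d) =
        top k 3 (X 0 ^ a * X 1 ^ b * X 2 ^ c * (X 0 * X 1) ^ d) -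
          top k 3 (X 0 ^ a * X 1 ^ b * X 2 ^ c * 0 ^ d)
      rw [show (X 0 ^ a * X 1 ^ b * X 2 ^ c * (X 0 * X 1) ^ d : W k 3 ∅) =
        X 0 ^ (a + d) * X 1 ^ (b + d) * X 2 ^ c by ring]
      simp only [zero_pow_eq, mul_ite, ite_mul, mul_one, one_mul, mul_zero, zero_mul,
        apply_ite (top k _), map_zero, top_two_monomial, top_three_monomial]
      split_ifs <;> first | (exfalso; omega) | simp
  exact LinearMap.congr_fun key t

/-- The linear coefficient of a strong difference is the difference of the top coefficients. -/
theorem top_lastAxis (t : W k 3 (lastRel 2 0 1)) :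
    top k 1 (lastAxis.alg t) = top k 2 ((psi 2 0 1).alg t) - top k 2 ((phi 2 0 1).alg t) := by
  have key : (top k 1).comp lastAxis.alg.toLinearMap =
      (top k 2).comp (psi 2 0 1).alg.toLinearMap - (top k 2).comp (phi 2 0 1).alg.toLinearMap := by
    refine linearMap_ext_monomial fun m => ?_
    simp only [LinearMap.sub_apply, LinearMap.comp_apply, AlgHom.toLinearMap_apply]
    rw [alg_monomial, alg_monomial, alg_monomial]
    rw [Fin.prod_univ_castSucc (n := 2), Fin.prod_univ_castSucc (n := 2),
      Fin.prod_univ_castSucc (n := 2)]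
    simp only [lastAxis, phi, psi, ofMap_X, Fin.snoc_castSucc, Fin.snoc_last]
    rw [Fin.prod_univ_two, Fin.prod_univ_two]
    change top k 1 (0 ^ m 0 * 0 ^ m 1 * X 0 ^ m 2) =
      top k 2 (X 0 ^ m 0 * X 1 ^ m 1 * (X 0 * X 1) ^ m 2) -
        top k 2 (X 0 ^ m 0 * X 1 ^ m 1 * 0 ^ m 2)
    rw [show (X 0 ^ m 0 * X 1 ^ m 1 * (X 0 * X 1) ^ m 2 : W k 2 ∅) =
      X 0 ^ (m 0 + m 2) * X 1 ^ (m 1 + m 2) by ring]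
    simp only [zero_pow_eq, mul_ite, ite_mul, mul_one, one_mul, mul_zero, zero_mul,
      apply_ite (top k _), map_zero, top_one_monomial, top_two_monomial]
    split_ifs <;> first | (exfalso; omega) | simp
  exact LinearMap.congr_fun key t

theorem top_diag (t : W k 2 {(0, 1)}) :
    top k 1 (diag.alg t) = top k 1 (axis₁.alg t) + top k 1 (axis₂.alg t) := by
  have key : (top k 1).comp diag.alg.toLinearMap =
      (top k 1).comp axis₁.alg.toLinearMap + (top k 1).comp axis₂.alg.toLinearMap := by
    refine linearMap_ext_monomial fun m => ?_
    simp only [LinearMap.add_apply, LinearMap.comp_apply, AlgHom.toLinearMap_apply]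
    rw [alg_monomial, alg_monomial, alg_monomial]
    simp only [Fin.prod_univ_two, diag, axis₁, axis₂, ofMap_X, Matrix.cons_val_zero,
      Matrix.cons_val_one]
    rw [← pow_add]
    simp only [zero_pow_eq, mul_ite, ite_mul, mul_one, one_mul, mul_zero, zero_mul,
      apply_ite (top k _), map_zero, top_one_monomial]
    split_ifs <;> first | (exfalso; omega) | simp
  exact LinearMap.congr_fun key t

/-! ### The Weil algebra of compatible hexagons of microcubes -/

theorem incl_alg_mk (n : ℕ) (i j : Fin n) (f : MvPolynomial (Fin n) k) :
    (incl n i j).alg (Ideal.Quotient.mk (relIdeal k n ∅) f : W k n ∅) =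
      (Ideal.Quotient.mk (relIdeal k n {(i, j)}) f : W k n {(i, j)}) := by
  change MvPolynomial.aeval (fun a => (X a : W k n {(i, j)})) f =
    Ideal.Quotient.mkₐ k (relIdeal k n {(i, j)}) f
  congr 1
  exact MvPolynomial.algHom_ext fun a => MvPolynomial.aeval_X _ a

theorem incl_alg_eq_iff {n : ℕ} {i j : Fin n} {a b : W k n ∅} :
    (incl n i j).alg a = (incl n i j).alg b ↔ ∀ m : {m // ¬ Bad (∅ : Set (Fin n × Fin n)) m},
      ¬ Bad {(i, j)} m.1 → coeffEquiv k n ∅ a m = coeffEquiv k n ∅ b m := by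
  obtain ⟨f, rfl⟩ : ∃ f, Ideal.Quotient.mk (relIdeal k n ∅) f = a := Ideal.Quotient.mk_surjective a
  obtain ⟨g, rfl⟩ : ∃ f, Ideal.Quotient.mk (relIdeal k n ∅) f = b := Ideal.Quotient.mk_surjective b
  rw [incl_alg_mk, incl_alg_mk]
  refine mk_eq_mk_iff.trans ⟨fun h m hm => h m.1 hm, fun h m hm => h ⟨m, fun hb => hm ?_⟩ hm⟩
  rcases hb with hb | ⟨_, hb, _⟩
  · exact Or.inl hb
  · exact hb.elim

/-- The restriction of microcubes from `D³` to `D³{(i, j)}`, where `i < j` are the two elements of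
`{0, 1, 2}` different from `l`. -/
noncomputable abbrev restr (k : Type u) [CommRing k] (l : Fin 3) :
    W k 3 ∅ ⟶ W k 3 {(l.succAbove 0, l.succAbove 1)} :=
  incl 3 (l.succAbove 0) (l.succAbove 1)

/-- The six microcubes form a cycle `321, 231, 213, 123, 132, 312` in which neighbours differ by
the exchange of two adjacent entries. The edge `e` joins the vertices `e` and `e + 1`; its direction
`l` is the entry that stays outside the exchange, numbered from `0`. -/
def edgeDir : Fin 6 → Fin 3 := ![0, 1, 2, 0, 1, 2]

/-- The six-tuples of elements of `𝒲_{D³}` whose neighbours agree on `D³{(i, j)}`, where `i < j` are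
the two directions exchanged along the edge. -/
noncomputable def hexSubalgebra (k : Type u) [CommRing k] : Subalgebra k (Fin 6 → W k 3 ∅) where
  carrier := {a | ∀ e, (restr k (edgeDir e)).alg (a e) = (restr k (edgeDir e)).alg (a (e + 1))}
  mul_mem' ha hb e := by
    rw [Pi.mul_apply, Pi.mul_apply, map_mul, map_mul, ha e, hb e]
  add_mem' ha hb e := by
    rw [Pi.add_apply, Pi.add_apply, map_add, map_add, ha e, hb e]
  algebraMap_mem' c e := by
    rw [Pi.algebraMap_apply, Pi.algebraMap_apply]

/-- The identification of coefficients of neighbouring microcubes expressed by `hexSubalgebra`. -/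
def hexRel (x y : Fin 6 × {m // ¬ Bad (∅ : Set (Fin 3 × Fin 3)) m}) : Prop :=
  y = (x.1 + 1, x.2) ∧
    ¬ Bad {((edgeDir x.1).succAbove 0, (edgeDir x.1).succAbove 1)} x.2.1

/-- The conditions that define `hexSubalgebra` equate coefficients in pairs, so that its elements
are the functions on the set of coefficients modulo the identifications. -/
noncomputable def hexEquiv (k : Type u) [CommRing k] : (Quot hexRel → k) ≃ₗ[k] hexSubalgebra k where
  toFun g := ⟨fun v => (coeffEquiv k 3 ∅).symm fun m => g (Quot.mk _ (v, m)), fun e => by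
    refine incl_alg_eq_iff.2 fun m hm => ?_
    refine (congrFun ((coeffEquiv k 3 ∅).apply_symm_apply _) m).trans ?_
    refine Eq.trans ?_ (congrFun ((coeffEquiv k 3 ∅).apply_symm_apply _) m).symm
    exact congrArg g (Quot.sound ⟨rfl, hm⟩)⟩
  map_add' g g' := Subtype.ext (funext fun v => by
    exact (coeffEquiv k 3 ∅).symm.map_add (fun m => g (Quot.mk _ (v, m)))
      (fun m => g' (Quot.mk _ (v, m))))
  map_smul' c g := Subtype.ext (funext fun v => by
    exact (coeffEquiv k 3 ∅).symm.map_smul c (fun m => g (Quot.mk _ (v, m))))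
  invFun a := Quot.lift (fun x => coeffEquiv k 3 ∅ (a.1 x.1) x.2) (by
    rintro ⟨e, m⟩ _ ⟨rfl, hm⟩
    exact incl_alg_eq_iff.1 (a.2 e) m hm)
  left_inv g := funext fun q => by
    induction q using Quot.ind with
    | mk x => exact congrFun ((coeffEquiv k 3 ∅).apply_symm_apply _) x.2
  right_inv a := Subtype.ext (funext fun v => (coeffEquiv k 3 ∅).symm_apply_apply (a.1 v))

instance : Finite (Quot hexRel) :=
  have := (finite_not_bad (∅ : Set (Fin 3 × Fin 3))).to_subtype
  have : Finite {m // ¬ Bad (∅ : Set (Fin 3 × Fin 3)) m} := this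
  inferInstance

instance : Module.Finite k (hexSubalgebra k) := Module.Finite.equiv (hexEquiv k)

instance : Module.Free k (hexSubalgebra k) := Module.Free.of_equiv (hexEquiv k)

theorem aug_eq_of_incl_alg_eq {n : ℕ} {i j : Fin n} {a b : W k n ∅}
    (h : (incl n i j).alg a = (incl n i j).alg b) : (W k n ∅).aug a = (W k n ∅).aug b := by
  rw [← (incl n i j).aug_comp, AlgHom.comp_apply, AlgHom.comp_apply, h]

theorem hexSubalgebra_aug (a : hexSubalgebra k) (v : Fin 6) :
    (W k 3 ∅).aug (a.1 v) = (W k 3 ∅).aug (a.1 0) := by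
  induction v using Fin.induction with
  | zero => rfl
  | succ v ih =>
    rw [← ih, ← Fin.coeSucc_eq_succ]
    exact (aug_eq_of_incl_alg_eq (a.2 v.castSucc)).symm

/-- The Weil algebra of compatible hexagons of microcubes. -/
noncomputable def hex (k : Type u) [CommRing k] : WeilAlg k where
  carrier := hexSubalgebra k
  aug := (W k 3 ∅).aug.comp ((Pi.evalAlgHom k _ 0).comp (hexSubalgebra k).val)
  nilp := by
    obtain ⟨r, hr⟩ := (W k 3 ∅).nilp
    refine ⟨r, (Submodule.eq_bot_iff _).2 fun a ha => Subtype.ext (funext fun v => ?_)⟩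
    -- Each projection maps the augmentation ideal into that of `𝒲_{D³}`.
    let q := (Pi.evalAlgHom k (fun _ : Fin 6 => (W k 3 ∅).carrier) v).comp (hexSubalgebra k).val
    have hq : Ideal.map q (RingHom.ker ((W k 3 ∅).aug.comp
        ((Pi.evalAlgHom k _ 0).comp (hexSubalgebra k).val))) ≤ RingHom.ker (W k 3 ∅).aug := by
      refine Ideal.map_le_iff_le_comap.2 fun b hb => ?_
      exact (hexSubalgebra_aug b v).trans hb
    have h := Ideal.pow_right_mono hq r (by
      rw [← Ideal.map_pow]
      exact Ideal.mem_map_of_mem q ha)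
    rw [hr] at h
    exact h

/-- The projection of a compatible hexagon to its microcube at the vertex `v`. -/
noncomputable def hexProj (k : Type u) [CommRing k] (v : Fin 6) : hex k ⟶ W k 3 ∅ where
  alg := (Pi.evalAlgHom k _ v).comp (hexSubalgebra k).val
  aug_comp := AlgHom.ext fun a => hexSubalgebra_aug a v

theorem hexProj_restr (e : Fin 6) :
    hexProj k e ≫ restr k (edgeDir e) = hexProj k (e + 1) ≫ restr k (edgeDir e) :=
  hom_ext (AlgHom.ext fun a => a.2 e)

/-! ### Fibre products of Weil algebras -/

/-- The universal property, among Weil algebras, of a fibre product described by elements; the lift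
respects the augmentations because the first projection does. -/
theorem exists_lift {P A B Z V : WeilAlg k} {f₁ : P ⟶ A} {f₂ : P ⟶ B} {g₁ : A ⟶ Z} {g₂ : B ⟶ Z}
    (h : ∀ a b, g₁.alg a = g₂.alg b → ∃! t, f₁.alg t = a ∧ f₂.alg t = b) {p : V ⟶ A} {q : V ⟶ B}
    (hpq : p ≫ g₁ = q ≫ g₂) : ∃ t : V ⟶ P, t ≫ f₁ = p ∧ t ≫ f₂ = q := by
  have hs : ∀ x, g₁.alg (p.alg x) = g₂.alg (q.alg x) := fun x =>
    DFunLike.congr_fun (congrArg Hom.alg hpq) x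
  choose t ht htu using fun x => h _ _ (hs x)
  have hu : ∀ x s, f₁.alg s = p.alg x → f₂.alg s = q.alg x → t x = s := fun x s h1 h2 =>
    (htu x s ⟨h1, h2⟩).symm
  refine ⟨⟨{ toFun := t
             map_one' := hu _ _ (by simp) (by simp)
             map_mul' := fun x y => hu _ _
               (by rw [map_mul, map_mul, (ht x).1, (ht y).1])
               (by rw [map_mul, map_mul, (ht x).2, (ht y).2])
             map_zero' := hu _ _ (by simp) (by simp)
             map_add' := fun x y => hu _ _
               (by rw [map_add, map_add, (ht x).1, (ht y).1])
               (by rw [map_add, map_add, (ht x).2, (ht y).2])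
             commutes' := fun c => hu _ _ (by simp) (by simp) }, AlgHom.ext fun x => ?_⟩,
    hom_ext (AlgHom.ext fun x => (ht x).1), hom_ext (AlgHom.ext fun x => (ht x).2)⟩
  change P.aug (t x) = V.aug x
  rw [← f₁.aug_comp, ← p.aug_comp]
  exact congrArg A.aug (ht x).1

theorem hom_ext_of_existsUnique {P A B Z V : WeilAlg k} {f₁ : P ⟶ A} {f₂ : P ⟶ B} {g₁ : A ⟶ Z}
    {g₂ : B ⟶ Z} (h : ∀ a b, g₁.alg a = g₂.alg b → ∃! t, f₁.alg t = a ∧ f₂.alg t = b)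
    (w : f₁ ≫ g₁ = f₂ ≫ g₂) {s t : V ⟶ P} (h₁ : s ≫ f₁ = t ≫ f₁) (h₂ : s ≫ f₂ = t ≫ f₂) : s = t :=
  hom_ext (AlgHom.ext fun x =>
    (h _ _ (DFunLike.congr_fun (congrArg Hom.alg w) (s.alg x))).unique ⟨rfl, rfl⟩
      ⟨(DFunLike.congr_fun (congrArg Hom.alg h₁) x).symm,
        (DFunLike.congr_fun (congrArg Hom.alg h₂) x).symm⟩)

/-! ### Strong differences of the microcubes of a hexagon -/

/-- A morphism out of `𝒲_{D³}` that kills the product of the two directions exchanged along an edge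
takes the same value on both ends of the edge. -/
theorem hexProj_comp {V : WeilAlg k} (e : Fin 6) (f : W k 3 ∅ ⟶ V)
    (h : f.alg (X ((edgeDir e).succAbove 0)) * f.alg (X ((edgeDir e).succAbove 1)) = 0) :
    hexProj k e ≫ f = hexProj k (e + 1) ≫ f := by
  obtain ⟨g, hg⟩ : ∃ g : W k 3 {((edgeDir e).succAbove 0, (edgeDir e).succAbove 1)} ⟶ V,
      ∀ i, g.alg (X i) = f.alg (X i) :=
    ⟨ofMap (fun i => f.alg (X i)) (fun i => by rw [← map_mul, X_sq, map_zero])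
      (by rintro a b h'; obtain ⟨rfl, rfl⟩ := Prod.ext_iff.1 h'; exact h)
      (fun i => (DFunLike.congr_fun f.aug_comp (X i)).trans (aug_X i)), ofMap_X _ _ _ _⟩
  have hg : restr k (edgeDir e) ≫ g = f := hom_ext_X fun i => by
    rw [comp_alg, AlgHom.comp_apply, ← hg]
    simp only [restr, incl, ofMap_X]
  rw [← hg, ← Category.assoc, ← Category.assoc, hexProj_restr]

/-- The mapping `D² → D³` that inserts `0` in place `l`. -/
noncomputable def face (k : Type u) [CommRing k] (l : Fin 3) : W k 3 ∅ ⟶ W k 2 ∅ :=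
  ofMap (l.insertNth (α := fun _ => W k 2 ∅) 0 X)
    (fun a => by induction a using Fin.succAboveCases l <;> simp [X_sq])
    (by simp) (fun a => by induction a using Fin.succAboveCases l <;> simp)

/-- The mapping `D → D³` onto the `l`-th axis. -/
noncomputable def axis (k : Type u) [CommRing k] (l : Fin 3) : W k 3 ∅ ⟶ W k 1 ∅ :=
  ofMap (Pi.single l (X 0))
    (fun a => by rcases eq_or_ne a l with rfl | h <;> simp [X_sq, *])
    (by simp) (fun a => by rcases eq_or_ne a l with rfl | h <;> simp [*])

/-- The mapping `D³{(0, 2), (1, 2)} → D⁴{(i, 3), (j, 3)}` that inserts `0` in place `l`, where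
`i < j` are the two elements of `{0, 1, 2}` different from `l`. -/
noncomputable def pairFace (k : Type u) [CommRing k] (l : Fin 3) :
    W k 4 (lastRel 3 (l.succAbove 0) (l.succAbove 1)) ⟶ W k 3 (lastRel 2 0 1) :=
  ofMap (Fin.snoc (α := fun _ => W k 3 (lastRel 2 0 1))
      (l.insertNth (α := fun _ => W k 3 (lastRel 2 0 1)) 0 fun i => X i.castSucc) (X (Fin.last 2)))
    (fun a => by
      induction a using Fin.lastCases with
      | last => rw [Fin.snoc_last, X_sq]
      | cast a => induction a using Fin.succAboveCases l <;> simp [X_sq])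
    (by
      rintro a b (h | h) <;> obtain ⟨rfl, rfl⟩ := Prod.ext_iff.1 h <;>
        simp only [Fin.snoc_last, Fin.snoc_castSucc, Fin.insertNth_apply_succAbove]
      · exact X_rel (Or.inl rfl)
      · exact X_rel (Or.inr rfl))
    (fun a => by
      induction a using Fin.lastCases with
      | last => rw [Fin.snoc_last, aug_X]
      | cast a => induction a using Fin.succAboveCases l <;> simp)

/-- Together with `pairFace_psi`: strong differences commute with the restriction of microcubes to
the face on which the `l`-th coordinate vanishes. -/
theorem pairFace_phi (l : Fin 3) : pairFace k l ≫ phi 2 0 1 = phi 3 _ _ ≫ face k l :=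
  hom_ext_X fun a => by
    rw [comp_alg, comp_alg, AlgHom.comp_apply, AlgHom.comp_apply]
    simp only [pairFace, phi, face, ofMap_X]
    induction a using Fin.lastCases with
    | last => simp only [Fin.snoc_last, ofMap_X, map_zero]
    | cast a => induction a using Fin.succAboveCases l <;> simp

theorem pairFace_psi (l : Fin 3) : pairFace k l ≫ psi 2 0 1 = psi 3 _ _ ≫ face k l :=
  hom_ext_X fun a => by
    rw [comp_alg, comp_alg, AlgHom.comp_apply, AlgHom.comp_apply]
    simp only [pairFace, psi, face, ofMap_X]
    induction a using Fin.lastCases with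
    | last =>
      simp only [Fin.snoc_last, ofMap_X, map_mul, Fin.insertNth_apply_succAbove]
    | cast a => induction a using Fin.succAboveCases l <;> simp

theorem slot_axis₁ (l : Fin 3) : slot {(0, 1)} l ≫ axis₁ = phi 3 _ _ ≫ axis k l :=
  hom_ext_X fun a => by
    rw [comp_alg, comp_alg, AlgHom.comp_apply, AlgHom.comp_apply]
    simp only [slot, axis₁, phi, axis, ofMap_X]
    induction a using Fin.lastCases with
    | last => simp only [Fin.snoc_last, ofMap_X, map_zero, Matrix.cons_val_one, Matrix.cons_val_zero]
    | cast a => rcases eq_or_ne a l with rfl | h <;> simp [*]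

theorem slot_axis₂ (l : Fin 3) : slot {(0, 1)} l ≫ axis₂ = pairFace k l ≫ lastAxis :=
  hom_ext_X fun a => by
    rw [comp_alg, comp_alg, AlgHom.comp_apply, AlgHom.comp_apply]
    simp only [slot, axis₂, pairFace, lastAxis, ofMap_X]
    induction a using Fin.lastCases with
    | last =>
      simp only [Fin.snoc_last, ofMap_X, Matrix.cons_val_one, Matrix.cons_val_zero]
      rfl
    | cast a =>
      induction a using Fin.succAboveCases l with
      | x => simp
      | p i => fin_cases i <;> simp

/-- An edge whose direction is not `l` exchanges `l` with another direction, so that the restriction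
to the face on which the `l`-th coordinate vanishes does not change along it. -/
theorem hexProj_face {e : Fin 6} {l : Fin 3} (h : edgeDir e ≠ l) :
    hexProj k e ≫ face k l = hexProj k (e + 1) ≫ face k l := by
  refine hexProj_comp e _ ?_
  obtain ⟨i, hi⟩ := Fin.exists_succAbove_eq h.symm
  fin_cases i
  · rw [show (edgeDir e).succAbove 0 = l from hi]
    simp [face]
  · rw [show (edgeDir e).succAbove 1 = l from hi]
    simp [face]

theorem hexProj_axis (e : Fin 6) (l : Fin 3) :
    hexProj k e ≫ axis k l = hexProj k (e + 1) ≫ axis k l := by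
  refine hexProj_comp e _ ?_
  simp only [axis, ofMap_X]
  rcases eq_or_ne ((edgeDir e).succAbove 0) l with h | h
  · have h' : (edgeDir e).succAbove 1 ≠ l := h ▸ by simp
    rw [Pi.single_eq_of_ne h', mul_zero]
  · rw [Pi.single_eq_of_ne h, zero_mul]

/-- The vertices of the hexagon at which the four microcubes entering the `l`-th iterated strong
difference lie. -/
def corner : Fin 3 → Fin 4 → Fin 6 := ![![0, 1, 4, 3], ![4, 5, 2, 1], ![2, 3, 0, 5]]

theorem corner_restr_left (l : Fin 3) :
    hexProj k (corner l 0) ≫ restr k l = hexProj k (corner l 1) ≫ restr k l := by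
  fin_cases l
  · exact hexProj_restr 0
  · exact hexProj_restr 4
  · exact hexProj_restr 2

theorem corner_restr_right (l : Fin 3) :
    hexProj k (corner l 2) ≫ restr k l = hexProj k (corner l 3) ≫ restr k l := by
  fin_cases l
  · exact (hexProj_restr 3).symm
  · exact (hexProj_restr 1).symm
  · exact (hexProj_restr 5).symm

theorem corner_face_fst (l : Fin 3) :
    hexProj k (corner l 0) ≫ face k l = hexProj k (corner l 2) ≫ face k l := by
  fin_cases l
  · exact ((hexProj_face (e := 4) (by decide)).trans (hexProj_face (e := 5) (by decide))).symm
  · exact ((hexProj_face (e := 2) (by decide)).trans (hexProj_face (e := 3) (by decide))).symm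
  · exact ((hexProj_face (e := 0) (by decide)).trans (hexProj_face (e := 1) (by decide))).symm

theorem corner_face_snd (l : Fin 3) :
    hexProj k (corner l 1) ≫ face k l = hexProj k (corner l 3) ≫ face k l := by
  fin_cases l
  · exact (hexProj_face (e := 1) (by decide)).trans (hexProj_face (e := 2) (by decide))
  · exact (hexProj_face (e := 5) (by decide)).trans (hexProj_face (e := 0) (by decide))
  · exact (hexProj_face (e := 3) (by decide)).trans (hexProj_face (e := 4) (by decide))

theorem hexProj_axis_eq (v : Fin 6) (l : Fin 3) :
    hexProj k v ≫ axis k l = hexProj k 0 ≫ axis k l := by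
  induction v using Fin.induction with
  | zero => rfl
  | succ v ih => exact Fin.coeSucc_eq_succ (a := v) ▸
      (hexProj_axis v.castSucc l).symm.trans ih

/-- The iterated strong difference of four of the six microcubes of a compatible hexagon is formed
in Weil algebras: `s` and `t` represent the two inner differences and `r` the outer one. That the
inner differences agree on `D(2)` is not a condition on the hexagon but a consequence of the
compatibilities along its edges. -/
theorem exists_corner_diff (k : Type u) [CommRing k] (l : Fin 3) :
    ∃ (s t : hex k ⟶ W k 4 (lastRel 3 (l.succAbove 0) (l.succAbove 1)))
      (r : hex k ⟶ W k 3 (lastRel 2 0 1)),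
      (s ≫ phi 3 _ _ = hexProj k (corner l 0) ∧ s ≫ psi 3 _ _ = hexProj k (corner l 1)) ∧
      (t ≫ phi 3 _ _ = hexProj k (corner l 2) ∧ t ≫ psi 3 _ _ = hexProj k (corner l 3)) ∧
      r ≫ phi 2 0 1 = s ≫ slot ∅ l ∧ r ≫ psi 2 0 1 = t ≫ slot ∅ l := by
  have hl : l.succAbove 0 ≠ l.succAbove 1 := by simp
  obtain ⟨s, hs⟩ := exists_lift (existsUnique_phi_psi 3 _ _ hl) (corner_restr_left (k := k) l)
  obtain ⟨t, ht⟩ := exists_lift (existsUnique_phi_psi 3 _ _ hl) (corner_restr_right (k := k) l)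
  -- The two inner differences agree along both axes of `D(2)`.
  have h₁ : s ≫ slot {(0, 1)} l ≫ axis₁ = t ≫ slot {(0, 1)} l ≫ axis₁ := by
    rw [slot_axis₁, ← Category.assoc, hs.1, ← Category.assoc, ht.1, hexProj_axis_eq,
      hexProj_axis_eq (corner l 2)]
  have hf : s ≫ pairFace k l = t ≫ pairFace k l := by
    refine hom_ext_of_existsUnique (existsUnique_phi_psi 2 0 1 (by decide))
      (phi_incl 2 0 1) ?_ ?_
    · rw [Category.assoc, Category.assoc, pairFace_phi, ← Category.assoc, hs.1, ← Category.assoc,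
        ht.1, corner_face_fst]
    · rw [Category.assoc, Category.assoc, pairFace_psi, ← Category.assoc, hs.2, ← Category.assoc,
        ht.2, corner_face_snd]
  have h₂ : s ≫ slot {(0, 1)} l ≫ axis₂ = t ≫ slot {(0, 1)} l ≫ axis₂ := by
    rw [slot_axis₂, ← Category.assoc, hf, Category.assoc]
  have h : (s ≫ slot ∅ l) ≫ incl 2 0 1 = (t ≫ slot ∅ l) ≫ incl 2 0 1 := by
    rw [Category.assoc, Category.assoc, slot_incl]
    refine hom_ext_of_existsUnique existsUnique_axis
      (by rw [comp_toBase, comp_toBase]) ?_ ?_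
    · rw [Category.assoc, Category.assoc, h₁]
    · rw [Category.assoc, Category.assoc, h₂]
  obtain ⟨r, hr⟩ := exists_lift (existsUnique_phi_psi 2 0 1 (by decide)) h
  exact ⟨s, t, r, hs, ht, hr⟩

theorem top_corner_diff {l : Fin 3}
    {s t : hex k ⟶ W k 4 (lastRel 3 (l.succAbove 0) (l.succAbove 1))}
    {r : hex k ⟶ W k 3 (lastRel 2 0 1)}
    (hs : s ≫ phi 3 _ _ = hexProj k (corner l 0) ∧ s ≫ psi 3 _ _ = hexProj k (corner l 1))
    (ht : t ≫ phi 3 _ _ = hexProj k (corner l 2) ∧ t ≫ psi 3 _ _ = hexProj k (corner l 3))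
    (hr : r ≫ phi 2 0 1 = s ≫ slot ∅ l ∧ r ≫ psi 2 0 1 = t ≫ slot ∅ l) (a : hex k) :
    top k 1 ((r ≫ lastAxis).alg a) =
      (top k 3 ((hexProj k (corner l 3)).alg a) - top k 3 ((hexProj k (corner l 2)).alg a)) -
      (top k 3 ((hexProj k (corner l 1)).alg a) - top k 3 ((hexProj k (corner l 0)).alg a)) := by
  rw [← hs.1, ← hs.2, ← ht.1, ← ht.2]
  simp only [comp_alg, AlgHom.comp_apply]
  rw [top_lastAxis, ← top_slot, ← top_slot, ← AlgHom.comp_apply, ← AlgHom.comp_apply,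
    ← AlgHom.comp_apply, ← AlgHom.comp_apply, ← comp_alg, ← comp_alg, ← comp_alg, ← comp_alg, hr.1,
    hr.2]

/-! ### Multiforks of Weil algebras and microlinear objects -/

/-- A fork of Weil algebras whose elements are the compatible families of elements is a limit cone
of commutative `k`-algebras. -/
theorem isLimit_multifork {J : MulticospanShape.{0, 0}} {I : MulticospanIndex J (WeilAlg k)}
    (c : Multifork I)
    (h : ∀ a : ∀ v, I.left v, (∀ e, (I.fst e).alg (a (J.fst e)) = (I.snd e).alg (a (J.snd e))) →
      ∃! t : c.pt, ∀ v, (c.ι v).alg t = a v) :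
    Nonempty (IsLimit ((toAlg k).mapCone c)) := by
  let p (s : Cone (I.multicospan ⋙ toAlg k)) (v : J.L) : s.pt →ₐ[k] I.left v :=
    (s.π.app (.left v)).hom
  have hp (s : Cone (I.multicospan ⋙ toAlg k)) (x : s.pt) (e : J.R) :
      (I.fst e).alg (p s (J.fst e) x) = (I.snd e).alg (p s (J.snd e) x) :=
    DFunLike.congr_fun (congrArg CommAlgCat.Hom.hom
      ((s.w (WalkingMulticospan.Hom.fst e)).trans (s.w (WalkingMulticospan.Hom.snd e)).symm)) x
  choose t ht hu using fun s x => h (fun v => p s v x) (hp s x)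
  have hu' (s) (x : s.pt) (y : c.pt) (hy : ∀ v, (c.ι v).alg y = p s v x) : t s x = y :=
    (hu s x y hy).symm
  let f (s : Cone (I.multicospan ⋙ toAlg k)) : s.pt →ₐ[k] c.pt :=
    { toFun := t s
      map_one' := hu' _ _ _ fun v => by simp
      map_mul' := fun x y => hu' _ _ _ fun v => by rw [map_mul, map_mul, ht, ht]
      map_zero' := hu' _ _ _ fun v => by simp
      map_add' := fun x y => hu' _ _ _ fun v => by rw [map_add, map_add, ht, ht]
      commutes' := fun r => hu' _ _ _ fun v => by simp }
  have hf (s : Cone (I.multicospan ⋙ toAlg k)) (v : J.L) :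
      CommAlgCat.ofHom (Y := c.pt) (f s) ≫ (toAlg k).map (c.ι v) = s.π.app (.left v) :=
    CommAlgCat.hom_ext (AlgHom.ext fun x => ht s x v)
  refine ⟨{ lift := fun s => CommAlgCat.ofHom (f s), fac := fun s => ?_, uniq := fun s m hm => ?_ }⟩
  · rintro (v | e)
    · exact hf s v
    · exact (congrArg (_ ≫ ·) (((toAlg k).mapCone c).w (WalkingMulticospan.Hom.fst e)).symm).trans
        ((Category.assoc _ _ _).symm.trans ((congrArg (· ≫ _) (hf s (J.fst e))).trans
          (s.w (WalkingMulticospan.Hom.fst e))))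
  · refine CommAlgCat.hom_ext (AlgHom.ext fun x => (hu' s x _ fun v => ?_).symm)
    exact DFunLike.congr_fun (congrArg CommAlgCat.Hom.hom (hm (.left v))) x

/-- The shape of a cycle of length six. -/
abbrev cycleShape : MulticospanShape.{0, 0} := { L := Fin 6, R := Fin 6, fst := id, snd := (· + 1) }

instance : Fintype cycleShape.L := inferInstanceAs (Fintype (Fin 6))
instance : Fintype cycleShape.R := inferInstanceAs (Fintype (Fin 6))
instance : DecidableEq cycleShape.L := inferInstanceAs (DecidableEq (Fin 6))
instance : DecidableEq cycleShape.R := inferInstanceAs (DecidableEq (Fin 6))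

/-- The cycle of six copies of `𝒲_{D³}` with the restrictions along its edges. -/
noncomputable def cycleIndex (k : Type u) [CommRing k] :
    MulticospanIndex cycleShape (WeilAlg k) where
  left _ := W k 3 ∅
  right e := W k 3 {((edgeDir e).succAbove 0, (edgeDir e).succAbove 1)}
  fst e := restr k (edgeDir e)
  snd e := restr k (edgeDir e)

end WeilAlg

namespace DGCategory

open WeilAlg

variable {k : Type u} [CommRing k] {C : Type w} [Category.{v} C] [HasFiniteLimits C]
  (𝓓 : DGCategory k C) {M : C}

/-- For a microlinear object `M` and a fork of Weil algebras that is a limit cone of `k`-algebras,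
compatible families of generalized elements lift along the image of the fork under `M ⊗ -`. -/
theorem Microlinear.exists_multiforkLift (hM : 𝓓.Microlinear M) {J : MulticospanShape.{0, 0}}
    [Fintype J.L] [Fintype J.R] [DecidableEq J.L] [DecidableEq J.R]
    {I : MulticospanIndex J (WeilAlg k)} (c : Multifork I)
    (hc : Nonempty (IsLimit ((toAlg k).mapCone c))) {Y : C}
    (γ : ∀ v, Y ⟶ 𝓓.tens M (I.left v))
    (h : ∀ e, γ (J.fst e) ≫ 𝓓.tmap M (I.fst e) = γ (J.snd e) ≫ 𝓓.tmap M (I.snd e)) :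
    ∃ δ : Y ⟶ 𝓓.tens M c.pt, ∀ v, δ ≫ 𝓓.tmap M (c.ι v) = γ v := by
  obtain ⟨hl⟩ := hM (WalkingMulticospan J) _ c hc
  let s : Cone (I.multicospan ⋙ 𝓓.tensFunctor M) :=
    { pt := Y
      π :=
        { app := fun x => match x with
            | .left v => γ v
            | .right e => γ (J.fst e) ≫ 𝓓.tmap M (I.fst e)
          naturality := by
            rintro _ _ (_ | e | e)
            · exact (Category.id_comp _).trans ((congrArg (_ ≫ ·)
                ((I.multicospan ⋙ 𝓓.tensFunctor M).map_id _)).trans (Category.comp_id _)).symm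
            · exact Category.id_comp _
            · exact (Category.id_comp _).trans (h e) } }
  exact ⟨hl.lift s, fun v => hl.fac s (.left v)⟩

/-- Six microcubes in a microlinear object that agree along the edges of the hexagon come from one
morphism to `M ⊗ hex`. -/
theorem Microlinear.exists_hexLift (hM : 𝓓.Microlinear M) {Y : C}
    (γ : Fin 6 → (Y ⟶ 𝓓.tens M (W k 3 ∅)))
    (h : ∀ e, γ e ≫ 𝓓.tmap M (restr k (edgeDir e)) = γ (e + 1) ≫ 𝓓.tmap M (restr k (edgeDir e))) :
    ∃ δ : Y ⟶ 𝓓.tens M (hex k), ∀ v, δ ≫ 𝓓.tmap M (hexProj k v) = γ v :=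
  Microlinear.exists_multiforkLift 𝓓 hM (I := cycleIndex k)
    (Multifork.ofι (cycleIndex k) (hex k) (hexProj k) hexProj_restr)
    (isLimit_multifork _ fun a ha =>
      ⟨⟨a, ha⟩, fun _ => rfl, fun _ ht => Subtype.ext (funext ht)⟩) γ h

/-! ### Factorization of the iterated strong differences -/

/-- A pair of morphisms that comes from Weil algebras is identified with the lift formed there. -/
theorem comp_pairIso (hM : 𝓓.Microlinear M) {n : ℕ} {i j : Fin n} (hij : i ≠ j) {Y : C}
    {V : WeilAlg k} (δ : Y ⟶ 𝓓.tens M V) (a : Y ⟶ 𝓓.Pair M n i j)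
    (t : V ⟶ W k (n + 1) (lastRel n i j))
    (h₁ : a ≫ pullback.fst _ _ = δ ≫ 𝓓.tmap M (t ≫ phi n i j))
    (h₂ : a ≫ pullback.snd _ _ = δ ≫ 𝓓.tmap M (t ≫ psi n i j)) :
    a ≫ (𝓓.pairIso hM hij).hom = δ ≫ 𝓓.tmap M t := by
  rw [← Iso.eq_comp_inv]
  change a = (δ ≫ 𝓓.tmap M t) ≫ 𝓓.toPair M n i j
  apply pullback.hom_ext
  · rw [h₁, ← tmap_comp, Category.assoc, Category.assoc, toPair, pullback.lift_fst]
  · rw [h₂, ← tmap_comp, Category.assoc, Category.assoc, toPair, pullback.lift_snd]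

/-- The projections of the limit of the hexagonal diagram to the copies of `M ⊗ 𝒲_{D³}` come from
one morphism to `M ⊗ hex`. -/
theorem exists_hexagonLift (hM : 𝓓.Microlinear M) : ∃ δ : 𝓓.Hexagon hM ⟶ 𝓓.tens M (hex k), ∀ l : Fin 3,
    Multiequalizer.ι (𝓓.hexagon hM) l ≫ 𝓓.proj₁ hM l = δ ≫ 𝓓.tmap M (hexProj k (corner l 0)) ∧
    Multiequalizer.ι (𝓓.hexagon hM) l ≫ 𝓓.proj₂ hM l = δ ≫ 𝓓.tmap M (hexProj k (corner l 1)) ∧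
    Multiequalizer.ι (𝓓.hexagon hM) l ≫ 𝓓.proj₃ hM l = δ ≫ 𝓓.tmap M (hexProj k (corner l 2)) ∧
    Multiequalizer.ι (𝓓.hexagon hM) l ≫ 𝓓.proj₄ hM l = δ ≫ 𝓓.tmap M (hexProj k (corner l 3)) := by
  let ι (l : Fin 3) : 𝓓.Hexagon hM ⟶ 𝓓.Quad hM l := Multiequalizer.ι (𝓓.hexagon hM) l
  have hc (l : Fin 3) : ι l ≫ 𝓓.proj₂₃ hM l = ι (l + 1) ≫ 𝓓.proj₄₁ hM (l + 1) :=
    Multiequalizer.condition (𝓓.hexagon hM) l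
  have h24 (l : Fin 3) : ι l ≫ 𝓓.proj₂ hM l = ι (l + 1) ≫ 𝓓.proj₄ hM (l + 1) := by
    have := congrArg (· ≫ pullback.fst _ _) (hc l)
    simpa only [Category.assoc, proj₂₃, proj₄₁, pullback.lift_fst] using this
  have h31 (l : Fin 3) : ι l ≫ 𝓓.proj₃ hM l = ι (l + 1) ≫ 𝓓.proj₁ hM (l + 1) := by
    have := congrArg (· ≫ pullback.snd _ _) (hc l)
    simpa only [Category.assoc, proj₂₃, proj₄₁, pullback.lift_snd] using this
  have h12 (l : Fin 3) : (ι l ≫ 𝓓.proj₁ hM l) ≫ 𝓓.tmap M (restr k l) =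
      (ι l ≫ 𝓓.proj₂ hM l) ≫ 𝓓.tmap M (restr k l) := by
    simp only [Category.assoc, proj₁, proj₂, pullback.condition]
  have h34 (l : Fin 3) : (ι l ≫ 𝓓.proj₄ hM l) ≫ 𝓓.tmap M (restr k l) =
      (ι l ≫ 𝓓.proj₃ hM l) ≫ 𝓓.tmap M (restr k l) := by
    simp only [Category.assoc, proj₃, proj₄, pullback.condition]
  let γ : Fin 6 → (𝓓.Hexagon hM ⟶ 𝓓.tens M (W k 3 ∅)) :=
    ![ι 0 ≫ 𝓓.proj₁ hM 0, ι 0 ≫ 𝓓.proj₂ hM 0, ι 2 ≫ 𝓓.proj₁ hM 2, ι 2 ≫ 𝓓.proj₂ hM 2,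
      ι 1 ≫ 𝓓.proj₁ hM 1, ι 1 ≫ 𝓓.proj₂ hM 1]
  obtain ⟨δ, hδ⟩ := Microlinear.exists_hexLift 𝓓 hM γ (fun e => by
    fin_cases e
    · exact h12 0
    · exact (congrArg (· ≫ 𝓓.tmap M (restr k 1)) (h24 0)).trans
        ((h34 1).trans (congrArg (· ≫ 𝓓.tmap M (restr k 1)) (h31 1)))
    · exact h12 2
    · exact (congrArg (· ≫ 𝓓.tmap M (restr k 0)) (h24 2)).trans
        ((h34 0).trans (congrArg (· ≫ 𝓓.tmap M (restr k 0)) (h31 0)))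
    · exact h12 1
    · exact (congrArg (· ≫ 𝓓.tmap M (restr k 2)) (h24 1)).trans
        ((h34 2).trans (congrArg (· ≫ 𝓓.tmap M (restr k 2)) (h31 2))))
  refine ⟨δ, fun l => ?_⟩
  fin_cases l
  · exact ⟨(hδ 0).symm, (hδ 1).symm, (h31 0).trans (hδ 4).symm, (h24 2).symm.trans (hδ 3).symm⟩
  · exact ⟨(hδ 4).symm, (hδ 5).symm, (h31 1).trans (hδ 2).symm, (h24 0).symm.trans (hδ 1).symm⟩
  · exact ⟨(hδ 2).symm, (hδ 3).symm, (h31 2).trans (hδ 0).symm, (h24 1).symm.trans (hδ 5).symm⟩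

/-- Each iterated strong difference is induced by a morphism of Weil algebras, whose linear
coefficient is the alternating sum of the top coefficients of four of the six microcubes. -/
theorem exists_iteratedZeta_eq (hM : 𝓓.Microlinear M) {δ : 𝓓.Hexagon hM ⟶ 𝓓.tens M (hex k)}
    {l : Fin 3}
    (h₁ : Multiequalizer.ι (𝓓.hexagon hM) l ≫ 𝓓.proj₁ hM l =
      δ ≫ 𝓓.tmap M (hexProj k (corner l 0)))
    (h₂ : Multiequalizer.ι (𝓓.hexagon hM) l ≫ 𝓓.proj₂ hM l =
      δ ≫ 𝓓.tmap M (hexProj k (corner l 1)))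
    (h₃ : Multiequalizer.ι (𝓓.hexagon hM) l ≫ 𝓓.proj₃ hM l =
      δ ≫ 𝓓.tmap M (hexProj k (corner l 2)))
    (h₄ : Multiequalizer.ι (𝓓.hexagon hM) l ≫ 𝓓.proj₄ hM l =
      δ ≫ 𝓓.tmap M (hexProj k (corner l 3))) :
    ∃ z : hex k ⟶ W k 1 ∅, 𝓓.iteratedZeta hM l = δ ≫ 𝓓.tmap M z ∧ ∀ a, top k 1 (z.alg a) =
      (top k 3 ((hexProj k (corner l 3)).alg a) - top k 3 ((hexProj k (corner l 2)).alg a)) -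
      (top k 3 ((hexProj k (corner l 1)).alg a) - top k 3 ((hexProj k (corner l 0)).alg a)) := by
  obtain ⟨s, t, r, hs, ht, hr⟩ := exists_corner_diff k l
  refine ⟨r ≫ lastAxis, ?_, top_corner_diff hs ht hr⟩
  let ι : 𝓓.Hexagon hM ⟶ 𝓓.Quad hM l := Multiequalizer.ι (𝓓.hexagon hM) l
  have hs' : (ι ≫ pullback.fst _ _) ≫ (𝓓.pairIso hM (succAbove_ne l)).hom = δ ≫ 𝓓.tmap M s :=
    comp_pairIso 𝓓 hM _ δ _ s (by rw [hs.1, ← h₁, proj₁, Category.assoc]; rfl)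
      (by rw [hs.2, ← h₂, proj₂, Category.assoc]; rfl)
  have ht' : (ι ≫ pullback.snd _ _) ≫ (𝓓.pairIso hM (succAbove_ne l)).hom = δ ≫ 𝓓.tmap M t :=
    comp_pairIso 𝓓 hM _ δ _ t (by rw [ht.1, ← h₃, proj₃, Category.assoc]; rfl)
      (by rw [ht.2, ← h₄, proj₄, Category.assoc]; rfl)
  have hr' : (ι ≫ 𝓓.zetaRelPair hM l) ≫ (𝓓.pairIso hM (zero_ne_one' (Fin 2))).hom =
      δ ≫ 𝓓.tmap M r := by
    refine comp_pairIso 𝓓 hM _ δ _ r ?_ ?_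
    · rw [hr.1, ← tmap_comp, ← Category.assoc δ, ← hs', zetaRelPair, Category.assoc,
        pullback.lift_fst, zetaRel]
      simp only [Category.assoc]
    · rw [hr.2, ← tmap_comp, ← Category.assoc δ, ← ht', zetaRelPair, Category.assoc,
        pullback.lift_snd, zetaRel]
      simp only [Category.assoc]
  rw [← tmap_comp, ← Category.assoc δ, ← hr', iteratedZeta, zeta]
  simp only [Category.assoc]
  rfl

/-! ### Sums and the zero section -/

/-- The sum of two tangent vectors induced by morphisms of Weil algebras is induced by a morphism
whose linear coefficient is the sum of theirs. -/
theorem exists_add_eq (hM : 𝓓.Microlinear M) {Y : C} {V : WeilAlg k} (δ : Y ⟶ 𝓓.tens M V)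
    (z z' : V ⟶ W k 1 ∅) : ∃ y : V ⟶ W k 1 ∅,
      (∀ h, 𝓓.add hM (δ ≫ 𝓓.tmap M z) (δ ≫ 𝓓.tmap M z') h = δ ≫ 𝓓.tmap M y) ∧
      ∀ a, top k 1 (y.alg a) = top k 1 (z.alg a) + top k 1 (z'.alg a) := by
  obtain ⟨t, h₁, h₂⟩ := exists_lift existsUnique_axis (p := z) (q := z')
    (by rw [comp_toBase, comp_toBase])
  refine ⟨t ≫ diag, fun h => ?_, fun a => ?_⟩
  · have e : pullback.lift _ _ h ≫ (𝓓.sumIso hM).hom = δ ≫ 𝓓.tmap M t := by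
      rw [← Iso.eq_comp_inv]
      apply pullback.hom_ext
      · rw [pullback.lift_fst, sumIso, Iso.symm_inv, Category.assoc, IsPullback.isoPullback_hom_fst,
          Category.assoc, tmap_comp, h₁]
      · rw [pullback.lift_snd, sumIso, Iso.symm_inv, Category.assoc, IsPullback.isoPullback_hom_snd,
          Category.assoc, tmap_comp, h₂]
    rw [add, ← Category.assoc, e, Category.assoc, tmap_comp]
  · rw [← h₁, ← h₂]
    exact top_diag (t.alg a)

theorem comp_base {Y : C} {V U : WeilAlg k} (δ : Y ⟶ 𝓓.tens M V) (z : V ⟶ U) :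
    (δ ≫ 𝓓.tmap M z) ≫ 𝓓.base M U = δ ≫ 𝓓.base M V := by
  rw [Category.assoc, tmap_base]

theorem base_zeroSection (V : WeilAlg k) :
    𝓓.base M V ≫ 𝓓.zeroSection M = 𝓓.tmap M (V.toBase ≫ (W k 1 ∅).unit) := by
  rw [base, zeroSection, Category.assoc, Iso.hom_inv_id_app_assoc, tmap_comp]

end DGCategory

/-! ### The general Jacobi identity -/

theorem theorem3p16 {k : Type u} [CommRing k] {C : Type w} [Category.{v} C] [HasFiniteLimits C]
    (𝓓 : DGCategory k C) (M : C) (hM : 𝓓.Microlinear M) (hexp : 𝓓.WeilExponentiable M) :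
    ∃ (h₁ : 𝓓.iteratedZeta hM 0 ≫ 𝓓.base M _ = 𝓓.iteratedZeta hM 1 ≫ 𝓓.base M _)
      (h₂ : 𝓓.add hM (𝓓.iteratedZeta hM 0) (𝓓.iteratedZeta hM 1) h₁ ≫ 𝓓.base M _ =
        𝓓.iteratedZeta hM 2 ≫ 𝓓.base M _),
      𝓓.add hM (𝓓.add hM (𝓓.iteratedZeta hM 0) (𝓓.iteratedZeta hM 1) h₁)
          (𝓓.iteratedZeta hM 2) h₂ =
        𝓓.iteratedZeta hM 2 ≫ 𝓓.base M _ ≫ 𝓓.zeroSection M := by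
  obtain ⟨δ, hδ⟩ := 𝓓.exists_hexagonLift hM
  have hz := fun l : Fin 3 =>
    𝓓.exists_iteratedZeta_eq hM (hδ l).1 (hδ l).2.1 (hδ l).2.2.1 (hδ l).2.2.2
  choose z hz htop using hz
  obtain ⟨y, hy, hytop⟩ := 𝓓.exists_add_eq hM δ (z 0) (z 1)
  obtain ⟨x, hx, hxtop⟩ := 𝓓.exists_add_eq hM δ y (z 2)
  -- Each of the six top coefficients enters the total sum once with each sign.
  have hzero : x = z 2 ≫ (WeilAlg.W k 1 ∅).toBase ≫ (WeilAlg.W k 1 ∅).unit := by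
    refine WeilAlg.hom_ext (AlgHom.ext fun a => WeilAlg.ext_aug_top ?_ ?_)
    · rw [← AlgHom.comp_apply, ← AlgHom.comp_apply, WeilAlg.Hom.aug_comp, WeilAlg.Hom.aug_comp]
    · have h0 : WeilAlg.top k 1 ((z 2 ≫ (WeilAlg.W k 1 ∅).toBase ≫ (WeilAlg.W k 1 ∅).unit).alg a) = 0 :=
        WeilAlg.top_one_algebraMap _
      rw [h0, hxtop, hytop, htop, htop, htop]
      simp only [WeilAlg.corner, Matrix.cons_val]
      ring
  simp only [hz, hy, hx]
  refine ⟨?_, ?_, ?_⟩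
  · rw [𝓓.comp_base, 𝓓.comp_base]
  · rw [𝓓.comp_base, 𝓓.comp_base]
  · rw [𝓓.base_zeroSection, Category.assoc, 𝓓.tmap_comp, hzero]
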